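/- Conventions. A monoid is a commutative cancellative monoid (written multiplicatively). For a monoid $D$, $\mathsf q(D)$ denotes its quotient group. For a reduced atomic monoid $H$ (reduced means that $1$ is its only unit), $\mathsf Z(H)$ is the free commutative monoid on the set $\mathcal A(H)$ of atoms of $H$, $\pi\colon\mathsf Z(H)\to H$ is the canonical homomorphism, $|z|$ is the length of $z\in\mathsf Z(H)$, and $\mathsf Z(a)=\pi^{-1}(a)$ is the set of factorizations of $a\in H$. $H$ is half-factorial (factorial) if for every $a\in H\setminus\{1\}$ the set of lengths $\{|z| : z\in \mathsf Z(a)\}$ (the set $\mathsf Z(a)$) has exactly one element. The monoid of relations is $\sim_H=\{(x,y)\in\mathsf Z(H)\times\mathsf Z(H):\pi(x)=\pi(y)\}$. An $\mathcal R$-chain concatenating $x$ and $y$ consists of factorizations $x=z_0,z_1,\dots,z_n=y$, $n\ge 1$, of one and the same element of $H$ with $\gcd(z_{i-1},z_i)\neq 1$ for all $i\in[1,n]$; it is monotone if $|z_{i-1}|\le|z_i|$ for all $i$, and of equal length if $|z_{i-1}|=|z_i|$ for all $i$. We write $x\approx y$ (respectively $x\approx_{\mathrm{eq}}y$) if there is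 an $\mathcal R$-chain (respectively an equal-length $\mathcal R$-chain) concatenating $x$ and $y$. With $\mathsf d(z,z')=\max\{|z/\gcd(z,z')|,|z'/\gcd(z,z')|\}$, the monotone catenary degree $\mathsf c_{\mathrm{mon}}(H)\in\mathbb N_0\cup\{\infty\}$ is the supremum over $a\in H$ of the smallest $N\in\mathbb N_0\cup\{\infty\}$ such that for all $z,z'\in\mathsf Z(a)$ with $|z|\le|z'|$ there are $z=z_0,\dots,z_n=z'$ in $\mathsf Z(a)$ with $\mathsf d(z_{i-1},z_i)\le N$ and $|z_{i-1}|\le|z_i|$ for all $i\in[1,n]$. A monoid $H$ is (finitely primary, of rank $1$, and) of type $(1,1)$ if it is a submonoid of a factorial monoid $F=[p]\times F^\times$ with a single prime $p$ up to units such that $H\setminus H^\times\subset pF\subset H\subsetneq F$ and $\mathsf v_p(H)=\mathbb N_0$. Lemma. Let $D=\mathcal F(P)\times D_1\times\dots\times D_r$ be a monoid, where $P\subset D$ is a set of prime elements, $\mathcal F(P)$ is the free commutative monoid on $P$, $r\ge 1$, and each $D_i$ is a reduced half-factorial but not factorial monoid of type $(1,1)$. Let $H\subset D$ be a saturated submonoid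 (that is, for $a,b\in H$, $a\mid b$ in $D$ implies $a\mid b$ in $H$), let $G=\mathsf q(D)/\mathsf q(H)$ be its class group (written additively), suppose that $|G|=2$ and that each class in $G$ contains some $p\in P$. Put $T=D_1\times\dots\times D_r$, let $\iota\colon T\to G$ be given by $\iota(t)=[t]=t\,\mathsf q(H)$, and let $$\mathcal B=\mathcal B(G,T,\iota)=\{St\in\mathcal F(G)\times T : \sigma(S)+\iota(t)=0\}$$ be the $T$-block monoid over $G$ defined by $\iota$, where $\mathcal F(G)$ is the free commutative monoid on $G$ and $\sigma(S)\in G$ is the sum of the terms of the sequence $S$. 1. If $(x,y)\in\sim_{\mathcal B}$ with $|y|\ge|x|$ and $|y|\ge 5$, then there is a monotone $\mathcal R$-chain concatenating $x$ and $y$; in particular $x\approx y$, and if $|x|=|y|$, then $x\approx_{\mathrm{eq}}y$. 2. Moreover, $$\mathsf c_{\mathrm{mon}}(\mathcal B)\le\sup\{|y| : (x,y)\in\mathcal A(\sim_{\mathcal B}),\ |x|\le|y|\le 4\}.$$ -/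

import Mathlib

namespace NonUniqueFactorization

universe u

/-! "Monoid" means commutative cancellative monoid, written multiplicatively. -/

/-- A monoid is reduced if its only unit is `1`. -/
def IsReducedMonoid (H : Type u) [CommMonoid H] : Prop := ∀ a : H, IsUnit a → a = 1

/-- Prime elements of a monoid. -/
def IsPrimeElement {D : Type u} [CommMonoid D] (p : D) : Prop :=
  ¬ IsUnit p ∧ ∀ a b : D, p ∣ a * b → p ∣ a ∨ p ∣ b

section Factorizations

/-! Factorizations. Everything in this section is used for reduced monoids `H` only, that is, for
monoids with `H = H_red`. -/

/-- The set of atoms of `H`, as a type. -/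
abbrev Atom (H : Type u) [CommMonoid H] : Type u := {w : H // Irreducible w}

/-- The factorization monoid: the free commutative monoid on the atoms of the reduced monoid `H`.
It is realized by multisets and hence written additively: the product of factorizations is `+`,
the trivial factorization is `0`, the length of `z` is `Multiset.card z`. -/
abbrev FactMonoid (H : Type u) [CommMonoid H] : Type u := Multiset (Atom H)

variable {H : Type u} [CommMonoid H]

/-- The factorization homomorphism. -/
def factProd (z : FactMonoid H) : H := (z.map Subtype.val).prod

/-- The set `Z(a)` of factorizations of `a`. -/
def factorizations (a : H) : Set (FactMonoid H) := {z | factProd z = a}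

/-- The set of lengths `L(a)`. -/
def lengths (a : H) : Set ℕ := Multiset.card '' factorizations a

variable (H) in
/-- `|L(a)| = 1` for all non-units `a`. -/
def IsHalfFactorial : Prop := ∀ a : H, ¬ IsUnit a → (lengths a).encard = 1

variable (H) in
/-- `|Z(a)| = 1` for all non-units `a`. -/
def IsFactorial : Prop := ∀ a : H, ¬ IsUnit a → (factorizations a).encard = 1

open Classical in
/-- The greatest common divisor of two factorizations in the free monoid of factorizations. -/
noncomputable def factGcd (z z' : FactMonoid H) : FactMonoid H := z ∩ z'

open Classical in
/-- The distance `max {|z / gcd(z, z')|, |z' / gcd(z, z')|}`. -/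
noncomputable def factDist (z z' : FactMonoid H) : ℕ :=
  max (Multiset.card (z - factGcd z z')) (Multiset.card (z' - factGcd z z'))

/-- There are `n ≥ 1` and factorizations `z = z₀, z₁, …, zₙ = z'` of `a` such that any two
successive ones satisfy `step`. -/
def Concatenated (step : FactMonoid H → FactMonoid H → Prop) (a : H) (z z' : FactMonoid H) :
    Prop :=
  Relation.TransGen (fun w w' => w ∈ factorizations a ∧ w' ∈ factorizations a ∧ step w w') z z'

/-- There is an R-chain concatenating `z` and `z'`. -/
def RRelated (z z' : FactMonoid H) : Prop :=
  ∃ a : H, Concatenated (fun w w' => factGcd w w' ≠ 0) a z z'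

/-- There is a monotone R-chain concatenating `z` and `z'` (lengths do not decrease from `z`
to `z'`). -/
def MonotoneRChain (z z' : FactMonoid H) : Prop :=
  ∃ a : H, Concatenated
    (fun w w' => factGcd w w' ≠ 0 ∧ Multiset.card w ≤ Multiset.card w') a z z'

/-- There is an equal-length R-chain concatenating `z` and `z'`. -/
def EqRRelated (z z' : FactMonoid H) : Prop :=
  ∃ a : H, Concatenated
    (fun w w' => factGcd w w' ≠ 0 ∧ Multiset.card w = Multiset.card w') a z z'

/-- There is a monotone `N`-chain in `Z(a)` concatenating `z` and `z'`. -/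
def MonotoneNChain (N : ℕ∞) (a : H) (z z' : FactMonoid H) : Prop :=
  Concatenated (fun w w' => (factDist w w' : ℕ∞) ≤ N ∧ Multiset.card w ≤ Multiset.card w') a z z'

/-- The monotone catenary degree of `a`: the smallest `N ∈ ℕ₀ ∪ {∞}` such that any two
factorizations `z, z'` of `a`, named so that `|z| ≤ |z'|`, are concatenated by a monotone
`N`-chain. -/
noncomputable def monCatenaryDegreeOf (a : H) : ℕ∞ :=
  sInf {N : ℕ∞ | ∀ z ∈ factorizations a, ∀ z' ∈ factorizations a,
    Multiset.card z ≤ Multiset.card z' → MonotoneNChain N a z z'}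

variable (H) in
/-- The monotone catenary degree of `H`. -/
noncomputable def monCatenaryDegree : ℕ∞ := ⨆ a : H, monCatenaryDegreeOf a

variable (H) in
/-- The monoid of relations `{(x, y) | π(x) = π(y)}`, a submonoid of `Z(H) × Z(H)`. -/
def relationMonoid : AddSubmonoid (FactMonoid H × FactMonoid H) where
  carrier := {s | factProd s.1 = factProd s.2}
  zero_mem' := rfl
  add_mem' := by
    intro s t hs ht
    simp only [Set.mem_ofPred_eq, factProd, Prod.fst_add, Prod.snd_add, Multiset.map_add,
      Multiset.prod_add] at hs ht ⊢
    rw [hs, ht]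

/-- `(x, y)` is an atom of the monoid of relations. -/
def IsRelationAtom (x y : FactMonoid H) : Prop :=
  ∃ h : (x, y) ∈ relationMonoid H, AddIrreducible (⟨(x, y), h⟩ : relationMonoid H)

end Factorizations

section FinitelyPrimary

/-- The injective homomorphism `j` makes `H` a submonoid of the factorial monoid `F = [p] × Fˣ`
in such a way that `H` is a finitely primary monoid of rank `1` and exponent `k`. -/
structure IsFinitelyPrimaryIn {H F : Type u} [CommMonoid H] [CommMonoid F]
    (j : H →* F) (p : F) (k : ℕ) : Prop where
  injective : Function.Injective j
  factorial : Function.Bijective (fun q : ℕ × Fˣ => p ^ q.1 * (q.2 : F))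
  one_le : 1 ≤ k
  nonunits : ∀ a : H, ¬ IsUnit a → ∃ f : F, j a = p * f
  exponent : ∀ f : F, p ^ k * f ∈ Set.range j
  minimal : ∀ i < k, ∃ f : F, p ^ i * f ∉ Set.range j

/-- `H` is a (finitely primary) monoid of type `(e, k)` (with rank `1`): it is finitely primary of
rank `1` and exponent `k` in some `F = [p] × Fˣ`, and `v_p(H) = e ℕ₀ ∪ ℕ_{≥ k}`. -/
def IsOfType (H : Type u) [CommMonoid H] (e k : ℕ) : Prop :=
  ∃ (F : Type u) (_ : CancelCommMonoid F) (j : H →* F) (p : F),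
    IsFinitelyPrimaryIn j p k ∧
    {n : ℕ | ∃ (a : H) (w : Fˣ), j a = p ^ n * (w : F)} = {n : ℕ | e ∣ n ∨ k ≤ n}

end FinitelyPrimary

section ClassGroup

variable {D : Type u} [CommMonoid D]

/-- `H ⊆ D` is saturated: divisibility in `D` of elements of `H` implies divisibility in `H`. -/
def IsSaturated (H : Submonoid D) : Prop :=
  ∀ a ∈ H, ∀ b ∈ H, a ∣ b → ∃ c ∈ H, b = a * c

/-- The quotient group `q(H)` of the submonoid `H`, as a subgroup of the quotient group `q(D)`. -/
def quotSubgroup (H : Submonoid D) : Subgroup (Algebra.GrothendieckGroup D) :=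
  Subgroup.closure (Algebra.GrothendieckGroup.of '' (H : Set D))

/-- The class group `q(D)/q(H)` of `H` in `D`, written multiplicatively. -/
abbrev ClassGrp (H : Submonoid D) : Type u := Algebra.GrothendieckGroup D ⧸ quotSubgroup H

/-- The class `[a]_{D/H}` of `a ∈ D` in the class group. -/
def classOf (H : Submonoid D) : D →* ClassGrp H :=
  (QuotientGroup.mk' (quotSubgroup H)).comp Algebra.GrothendieckGroup.of

/-- `D` is the (inner) direct product `F(P) × D₁ × … × D_r` of the free monoid on `P ⊆ D` and
the submonoids `Dᵢ ⊆ D`. -/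
def IsDirectProduct (P : Set D) {r : ℕ} (Di : Fin r → Submonoid D) : Prop :=
  Function.Bijective (fun q : Multiset P × ((i : Fin r) → Di i) =>
    (q.1.map Subtype.val).prod * ∏ i, (q.2 i : D))

/-- The homomorphism `ι : D₁ × … × D_r → q(D)/q(H)`, `ι(t) = [t]_{D/H}`. -/
def iotaHom (H : Submonoid D) {r : ℕ} (Di : Fin r → Submonoid D) :
    ((i : Fin r) → Di i) →* ClassGrp H :=
  (classOf H).comp
    { toFun := fun t => ∏ i, (t i : D)
      map_one' := by simp
      map_mul' := fun s t => by simp [Finset.prod_mul_distrib] }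

end ClassGroup

/-- The `T`-block monoid `B(G, T, ι) = {S t ∈ F(G) × T | σ(S) + ι(t) = 0}`. The abelian group `G`
is written multiplicatively here, so that `σ(S)` is the product of the terms of the sequence `S`,
an element of the free commutative monoid `F(G)` of multisets over `G`. -/
def TBlockMonoid {G T : Type u} [CommGroup G] [CommMonoid T] (ι : T →* G) :
    Submonoid (Multiplicative (Multiset G) × T) where
  carrier := {s | (Multiplicative.toAdd s.1).prod * ι s.2 = 1}
  one_mem' := by simp
  mul_mem' := by
    intro s t hs ht
    simp only [Set.mem_ofPred_eq, Prod.fst_mul, Prod.snd_mul, toAdd_mul, Multiset.prod_add,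
      map_mul] at hs ht ⊢
    rw [mul_mul_mul_comm, hs, ht, one_mul]

end NonUniqueFactorization

namespace NonUniqueFactorization

/-! ### Monotone R-chains: composition, reversal and partial replacement. -/

section Chains

variable {H : Type*} [CommMonoid H]

/-! Write the ambient monoid as `M = F(G) × D₁ × … × D_r` and let `φ : M → G` be the class map, so
that the block monoid is the kernel of `φ`. Valuations on the `Dᵢ` and multiplicities on `G` grade
`M`, with one color for each element of `G` and each index `i`. The inclusion `pF ⊆ Dᵢ` yields the
decisive exchange property: an element with degree at least two in a color is divisible by every
element of degree one in that color (`exists_isDegreeFunction`, `isColoredKernel_blockMonoid`). Call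
an element of degree one even if it lies in the kernel and odd otherwise. Since `|G| = 2`, an atom
of the block monoid is either one even element, a "single" `(i)`, or a product of two odd ones, a
"pair" `(i j)`; a pair `(i i)` is an atom only if color `i` has no even element (`single_or_pair`,
`isPair_admissible`, `exists_pair`).

Replacing some, but not all, atoms of `x` by at least as many atoms with the same product is a step
of a monotone R-chain. If `x` has at least three atoms and some atom of `x` has the same colors as
an atom of `y`, such steps, each touching two atoms, produce that atom of `y` itself
(`chain_of_common_deg`). So it suffices to create the right colors by moves on `x`, such as `(i u)(i
v) = (i)(i)(u v)`.

The length of a factorization plus its number of pairs depends only on the product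
(`card_add_numPairs`), and so does the parity of the number of odd factors of each color
(`pr_factProd_eq_one_iff`). If `|x| < |y|`, then `x` has more pairs, hence a color with a surplus of
odd factors, which `y` has among its singles, and the pairs of that color in `x` are split
(`chain_of_card_lt`). If `|x| = |y|`, a surplus color of `x` is traded against one of `y`, or pairs
are recombined when no color has a surplus (`chain_of_card_eq`).

The bound on the monotone catenary degree follows formally: along an R-chain common divisors are
cancelled, which shortens the factorizations and permits induction on `|y|`
(`monCatenaryDegree_le_sSup`). -/

@[simp]
theorem factProd_zero : factProd (0 : FactMonoid H) = 1 := by simp [factProd]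

@[simp]
theorem factProd_add (z w : FactMonoid H) : factProd (z + w) = factProd z * factProd w := by
  simp [factProd]

@[simp]
theorem factProd_cons (u : Atom H) (w : FactMonoid H) :
    factProd (u ::ₘ w) = u.1 * factProd w := by
  simp [factProd]

@[simp]
theorem factProd_singleton (u : Atom H) : factProd ({u} : FactMonoid H) = u.1 := by
  simp [factProd]

theorem factGcd_ne_zero {z w : FactMonoid H} {u : Atom H} (hz : u ∈ z) (hw : u ∈ w) :
    factGcd z w ≠ 0 := by
  classical
  intro h
  have : u ∈ factGcd z w := by
    rw [factGcd]
    exact Multiset.mem_inter.2 ⟨hz, hw⟩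
  simp [h] at this

theorem factGcd_comm (z w : FactMonoid H) : factGcd z w = factGcd w z := by
  classical
  simp only [factGcd]
  exact Multiset.inter_comm _ _

theorem MonotoneRChain.of_common {z w : FactMonoid H} {u : Atom H} (hz : u ∈ z) (hw : u ∈ w)
    (h : factProd z = factProd w) (hc : Multiset.card z ≤ Multiset.card w) :
    MonotoneRChain z w :=
  ⟨factProd z, Relation.TransGen.single ⟨rfl, h.symm, factGcd_ne_zero hz hw, hc⟩⟩

theorem MonotoneRChain.factProd_eq {z w : FactMonoid H} (h : MonotoneRChain z w) :
    factProd z = factProd w := by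
  obtain ⟨a, h⟩ := h
  have h1 : factProd z = a := by
    obtain ⟨_, h, _⟩ := Relation.TransGen.head'_iff.1 h
    exact h.1
  have h2 : factProd w = a := by
    obtain ⟨_, _, h⟩ := Relation.TransGen.tail'_iff.1 h
    exact h.2.1
  rw [h1, h2]

theorem MonotoneRChain.trans {z w v : FactMonoid H} (h : MonotoneRChain z w)
    (h' : MonotoneRChain w v) : MonotoneRChain z v := by
  obtain ⟨a, h⟩ := h
  obtain ⟨b, h'⟩ := h'
  have h1 : factProd w = a := by
    obtain ⟨_, _, h⟩ := Relation.TransGen.tail'_iff.1 h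
    exact h.2.1
  have h2 : factProd w = b := by
    obtain ⟨_, h, _⟩ := Relation.TransGen.head'_iff.1 h'
    exact h.1
  obtain rfl : a = b := h1.symm.trans h2
  exact ⟨a, Relation.TransGen.trans h h'⟩

theorem Concatenated.card_le {P : FactMonoid H → FactMonoid H → Prop} {a : H}
    {z w : FactMonoid H}
    (h : Concatenated (fun w w' => P w w' ∧ Multiset.card w ≤ Multiset.card w') a z w) :
    Multiset.card z ≤ Multiset.card w := by
  induction h with
  | single h => exact h.2.2.2
  | tail _ h ih => exact ih.trans h.2.2.2

theorem MonotoneRChain.card_le {z w : FactMonoid H} (h : MonotoneRChain z w) :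
    Multiset.card z ≤ Multiset.card w := by
  obtain ⟨a, h⟩ := h
  exact Concatenated.card_le h

/-- Lengths never decrease along the chain, so equal lengths at the ends force equality throughout.
-/
theorem MonotoneRChain.eqRRelated {z w : FactMonoid H} (h : MonotoneRChain z w)
    (hc : Multiset.card z = Multiset.card w) : EqRRelated z w := by
  obtain ⟨a, h⟩ := h
  refine ⟨a, ?_⟩
  unfold Concatenated at h ⊢
  induction h with
  | single h => exact Relation.TransGen.single ⟨h.1, h.2.1, h.2.2.1, hc⟩
  | tail h1 h ih =>
    have h3 := Concatenated.card_le h1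
    have h4 := h.2.2.2
    exact Relation.TransGen.tail (ih (by omega)) ⟨h.1, h.2.1, h.2.2.1, by omega⟩

theorem MonotoneRChain.symm {z w : FactMonoid H} (h : MonotoneRChain z w)
    (hc : Multiset.card z = Multiset.card w) : MonotoneRChain w z := by
  obtain ⟨a, h⟩ := h.eqRRelated hc
  refine ⟨a, ?_⟩
  refine Relation.TransGen.mono ?_ _ _ (Relation.TransGen.swap _ _ h)
  intro u v huv
  exact ⟨huv.2.1, huv.1, by rw [factGcd_comm]; exact huv.2.2.1, huv.2.2.2.ge⟩

theorem MonotoneRChain.rRelated {z w : FactMonoid H} (h : MonotoneRChain z w) :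
    RRelated z w := by
  obtain ⟨a, h⟩ := h
  exact ⟨a, Relation.TransGen.mono (fun u v huv => ⟨huv.1, huv.2.1, huv.2.2.1⟩) _ _ h⟩

/-- The untouched part `R` is a nontrivial common divisor. All later moves are instances of this
step. -/
theorem MonotoneRChain.replace {A A' R : FactMonoid H} (hR : R ≠ 0)
    (h : factProd A = factProd A') (hc : Multiset.card A ≤ Multiset.card A') :
    MonotoneRChain (A + R) (A' + R) := by
  obtain ⟨u, hu⟩ := Multiset.exists_mem_of_ne_zero hR
  exact MonotoneRChain.of_common (u := u) (by simp [hu]) (by simp [hu]) (by simp [h])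
    (by simpa using hc)

end Chains

/-! ### From monotone R-chains to the monotone catenary degree. -/

section MonotoneCatenaryDegree

variable {H : Type*} [CommMonoid H]

theorem eq_zero_of_isUnit_factProd {z : FactMonoid H} (h : IsUnit (factProd z)) : z = 0 := by
  induction z using Multiset.induction with
  | empty => rfl
  | cons u z _ =>
    rw [factProd_cons] at h
    exact absurd (isUnit_of_mul_isUnit_left h) u.2.not_isUnit

theorem eq_singleton_of_factProd_eq {z : FactMonoid H} {u : Atom H} (h : factProd z = u.1) :
    z = {u} := by
  induction z using Multiset.induction with
  | empty =>
    rw [factProd_zero] at h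
    exact absurd (h ▸ isUnit_one) u.2.not_isUnit
  | cons v z _ =>
    rw [factProd_cons] at h
    rcases u.2.isUnit_or_isUnit h.symm with h' | h'
    · exact absurd h' v.2.not_isUnit
    · obtain rfl := eq_zero_of_isUnit_factProd h'
      have : v = u := Subtype.ext (by simpa using h)
      rw [this]
      rfl

theorem eq_of_factProd_eq_of_card_le_one {z w : FactMonoid H} (h : factProd z = factProd w)
    (hw : Multiset.card w ≤ 1) : z = w := by
  rcases Nat.le_one_iff_eq_zero_or_eq_one.1 hw with h0 | h1
  · rw [Multiset.card_eq_zero] at h0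
    subst h0
    exact eq_zero_of_isUnit_factProd (by simp [h])
  · obtain ⟨u, rfl⟩ := Multiset.card_eq_one.1 h1
    exact eq_singleton_of_factProd_eq (by simpa [factProd] using h)

theorem factDist_add_right (z w g : FactMonoid H) :
    factDist (z + g) (w + g) = factDist z w := by
  classical
  have : factGcd (z + g) (w + g) = factGcd z w + g := by
    simp only [factGcd]
    ext u
    simp only [Multiset.count_inter, Multiset.count_add]
    omega
  simp only [factDist, this, add_tsub_add_eq_tsub_right]

theorem factDist_le (z w : FactMonoid H) :
    factDist z w ≤ max (Multiset.card z) (Multiset.card w) := by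
  classical
  unfold factDist
  exact max_le_max (Multiset.card_le_card tsub_le_self) (Multiset.card_le_card tsub_le_self)

theorem MonotoneNChain.add_right {N : ℕ∞} {a : H} {z w : FactMonoid H}
    (h : MonotoneNChain N a z w) (g : FactMonoid H) :
    MonotoneNChain N (a * factProd g) (z + g) (w + g) := by
  refine Relation.TransGen.lift (fun v => v + g) ?_ _ _ h
  rintro u v ⟨h1, h2, h3, h4⟩
  refine ⟨?_, ?_, ?_, ?_⟩
  · simp only [factorizations, Set.mem_ofPred_eq] at h1 ⊢
    simp [h1]
  · simp only [factorizations, Set.mem_ofPred_eq] at h2 ⊢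
    simp [h2]
  · rwa [factDist_add_right]
  · simpa using h4

theorem exists_add_of_not_isRelationAtom {x y : FactMonoid H} (h : factProd x = factProd y)
    (hy : y ≠ 0) (hna : ¬ IsRelationAtom x y) :
    ∃ u u' v v' : FactMonoid H, x = u + v ∧ y = u' + v' ∧ factProd u = factProd u' ∧
      factProd v = factProd v' ∧ u' ≠ 0 ∧ v' ≠ 0 := by
  -- A relation with trivial second component is trivial, because a product of atoms that is a unit
  -- is empty. Hence both parts of a proper decomposition contribute to `y`.
  have key : ∀ s : relationMonoid H, ¬ IsAddUnit s → s.1.2 ≠ 0 := by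
    intro s hs h0
    apply hs
    have hp : factProd s.1.1 = factProd s.1.2 := s.2
    have h1 : s.1.1 = 0 := eq_zero_of_isUnit_factProd (by rw [hp, h0]; simp)
    have : s = 0 := Subtype.ext (Prod.ext h1 h0)
    rw [this]
    exact isAddUnit_zero
  have hmem : (x, y) ∈ relationMonoid H := h
  by_contra hcon
  apply hna
  refine ⟨hmem, ?_, ?_⟩
  · intro hu
    obtain ⟨s, hs⟩ := isAddUnit_iff_exists_neg.1 hu
    have : y + s.1.2 = 0 := congrArg (fun t : relationMonoid H => t.1.2) hs
    exact hy (eq_zero_of_add_right this)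
  · intro s t hst
    by_contra hst'
    push Not at hst'
    apply hcon
    have e : (x, y) = s.1 + t.1 := congrArg Subtype.val hst
    exact ⟨s.1.1, s.1.2, t.1.1, t.1.2, congrArg Prod.fst e, congrArg Prod.snd e, s.2, t.2,
      key s hst'.1, key t hst'.2⟩

/-- Induction on `|y|`. For `|y| ≥ 5`, each step of the R-chain has a nontrivial gcd; after
cancelling it the induction hypothesis applies, and adding it back preserves distances. For `|y| ≤
4`, the relation is either an atom, bridged in a single step, or a product of two relations treated
separately. -/
theorem monotoneNChain_of_monotoneRChain (hcancel : ∀ a b c : H, a * b = a * c → b = c)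
    (hchain : ∀ x y : FactMonoid H, factProd x = factProd y →
      Multiset.card x ≤ Multiset.card y → 5 ≤ Multiset.card y → MonotoneRChain x y)
    {N : ℕ∞} (hN : ∀ x y : FactMonoid H, IsRelationAtom x y →
      Multiset.card x ≤ Multiset.card y → Multiset.card y ≤ 4 → (Multiset.card y : ℕ∞) ≤ N)
    (x y : FactMonoid H) (h : factProd x = factProd y)
    (hxy : Multiset.card x ≤ Multiset.card y) : MonotoneNChain N (factProd y) x y := by
  classical
  induction hn : Multiset.card y using Nat.strong_induction_on generalizing x y with
  | _ n ih =>
  subst hn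
  by_cases h5 : 5 ≤ Multiset.card y
  · obtain ⟨a, hch⟩ := hchain x y h hxy h5
    have ha : factProd y = a := by
      obtain ⟨_, _, h⟩ := Relation.TransGen.tail'_iff.1 hch
      exact h.2.1
    have step : ∀ w w' : FactMonoid H, factProd w = a → factProd w' = a →
        factGcd w w' ≠ 0 → Multiset.card w ≤ Multiset.card w' →
        Multiset.card w' ≤ Multiset.card y → MonotoneNChain N a w w' := by
      intro w w' hw hw' hg hc hcy
      set g := factGcd w w' with hgdef
      have e1 : w = (w - g) + g := by
        rw [tsub_add_cancel_of_le]
        rw [hgdef, factGcd]; exact Multiset.inter_le_left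
      have e2 : w' = (w' - g) + g := by
        rw [tsub_add_cancel_of_le]
        rw [hgdef, factGcd]; exact Multiset.inter_le_right
      have c1 := congrArg Multiset.card e1
      have c2 := congrArg Multiset.card e2
      rw [Multiset.card_add] at c1 c2
      have hg0 : 0 < Multiset.card g := Multiset.card_pos.2 hg
      have e3 : factProd (w - g) = factProd (w' - g) := by
        apply hcancel (factProd g)
        rw [mul_comm, mul_comm (factProd g), ← factProd_add, ← factProd_add, ← e1, ← e2, hw, hw']
      have := (ih _ (by omega) (w - g) (w' - g) e3 (by omega) rfl).add_right g
      rwa [← factProd_add, ← e1, ← e2, hw'] at this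
    rw [ha]
    unfold Concatenated at hch
    induction hch using Relation.TransGen.head_induction_on with
    | single h' => exact step _ _ h'.1 h'.2.1 h'.2.2.1 h'.2.2.2 le_rfl
    | head h' hrest ih' =>
      have hc := Concatenated.card_le hrest
      exact Relation.TransGen.trans (step _ _ h'.1 h'.2.1 h'.2.2.1 h'.2.2.2 hc)
        (ih' (h'.2.1.trans ha.symm) hc)
  · by_cases hy : Multiset.card y ≤ 1
    · obtain rfl := eq_of_factProd_eq_of_card_le_one h hy
      refine Relation.TransGen.single ⟨rfl, rfl, ?_, le_rfl⟩
      have : factDist x x = 0 := by simp [factDist, factGcd, ← Multiset.inf_eq_inter]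
      simp [this]
    by_cases hat : IsRelationAtom x y
    · refine Relation.TransGen.single ⟨h, rfl, ?_, hxy⟩
      refine le_trans ?_ (hN x y hat hxy (by omega))
      have := factDist_le x y
      rw [max_eq_right hxy] at this
      exact_mod_cast this
    · obtain ⟨u, u', v, v', rfl, rfl, hu, hv, hu0, hv0⟩ :=
        exists_add_of_not_isRelationAtom h (by rintro rfl; simp at hy) hat
      simp only [Multiset.card_add] at *
      have pu : 0 < Multiset.card u' := Multiset.card_pos.2 hu0
      have pv : 0 < Multiset.card v' := Multiset.card_pos.2 hv0
      have small : ∀ s s' : FactMonoid H, factProd s = factProd s' →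
          Multiset.card s ≠ Multiset.card s' →
          2 ≤ Multiset.card s ∧ 2 ≤ Multiset.card s' := by
        intro s s' hs hne
        constructor
        · by_contra hlt
          exact hne (by rw [eq_of_factProd_eq_of_card_le_one hs.symm (by omega)])
        · by_contra hlt
          exact hne (by rw [eq_of_factProd_eq_of_card_le_one hs (by omega)])
      -- Both partial relations are again monotone: two factorizations of different lengths of one
      -- element each have length at least two. If both parts were unbalanced, then `|x| ≤ |y| ≤ 4`
      -- would force all four lengths to equal two.
      have hle : Multiset.card u ≤ Multiset.card u' ∧ Multiset.card v ≤ Multiset.card v' := by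
        by_cases q1 : Multiset.card u = Multiset.card u'
        · omega
        by_cases q2 : Multiset.card v = Multiset.card v'
        · omega
        have := small u u' hu q1
        have := small v v' hv q2
        omega
      have c1 := (ih _ (by omega) u u' hu hle.1 rfl).add_right v
      have c2 := (ih _ (by omega) v v' hv hle.2 rfl).add_right u'
      rw [hv] at c1
      rw [mul_comm, add_comm v, add_comm v'] at c2
      rw [factProd_add]
      exact Relation.TransGen.trans c1 c2

theorem monCatenaryDegree_le_sSup (hcancel : ∀ a b c : H, a * b = a * c → b = c)
    (hchain : ∀ x y : FactMonoid H, factProd x = factProd y →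
      Multiset.card x ≤ Multiset.card y → 5 ≤ Multiset.card y → MonotoneRChain x y) :
    monCatenaryDegree H ≤ sSup {n : ℕ∞ | ∃ x y : FactMonoid H, IsRelationAtom x y ∧
      Multiset.card x ≤ Multiset.card y ∧ Multiset.card y ≤ 4 ∧
      n = (Multiset.card y : ℕ∞)} := by
  refine iSup_le fun a => sInf_le ?_
  intro z hz w hw hzw
  have hz' : factProd z = a := hz
  have hw' : factProd w = a := hw
  have := monotoneNChain_of_monotoneRChain hcancel hchain
    (N := sSup {n : ℕ∞ | ∃ x y : FactMonoid H, IsRelationAtom x y ∧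
      Multiset.card x ≤ Multiset.card y ∧ Multiset.card y ≤ 4 ∧
      n = (Multiset.card y : ℕ∞)})
    (fun x y h1 h2 h3 => le_sSup ⟨x, y, h1, h2, h3, rfl⟩) z w (hz'.trans hw'.symm) hzw
  rwa [hw'] at this

end MonotoneCatenaryDegree

/-! ### The colored model and the shape of its atoms. -/

section ColoredModel

variable {M I G : Type*} [CommMonoid M] [CommGroup G]

/-- `M` is a graded monoid which is a product of components indexed by the colors `i : I`, where
every component is of type `(1, 1)` or free of rank one, and `B` is the kernel of a homomorphism
`φ` from `M` to a group with at most two elements. Here `deg m` is the multiset of colors of `m`,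
and `pr i` is the projection to the component `i`. -/
structure IsColoredKernel [DecidableEq I] (deg : M → Multiset I) (pr : I → M →* M) (φ : M →* G)
    (B : Submonoid M) : Prop where
  deg_mul : ∀ a b, deg (a * b) = deg a + deg b
  eq_one : ∀ a, deg a = 0 → a = 1
  exists_dvd : ∀ a i, i ∈ deg a → ∃ u, deg u = {i} ∧ u ∣ a
  dvd : ∀ a i u, 2 ≤ (deg a).count i → deg u = {i} → u ∣ a
  pr_self : ∀ i a, (∀ j ∈ deg a, j = i) → pr i a = a
  pr_eq_one : ∀ i a, i ∉ deg a → pr i a = 1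
  mul_eq_one : ∀ g h : G, g ≠ 1 → h ≠ 1 → g * h = 1
  mem_iff : ∀ a, a ∈ B ↔ φ a = 1

/-- There is an element of degree `{i}` in the kernel of `φ`. -/
def HasEven (deg : M → Multiset I) (φ : M →* G) (i : I) : Prop := ∃ u, deg u = {i} ∧ φ u = 1

/-- The product of two elements of degrees `{i}`, `{j}` outside the kernel is an atom of the
kernel. -/
def Admissible (deg : M → Multiset I) (φ : M →* G) (i j : I) : Prop :=
  i ≠ j ∨ ¬ HasEven deg φ i

/-- `w` is the product of two elements of degrees `{i}`, `{j}` outside the kernel. -/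
def IsPair {B : Submonoid M} (deg : M → Multiset I) (φ : M →* G) (w : Atom B) (i j : I) : Prop :=
  ∃ a b : M, (w.1 : M) = a * b ∧ deg a = {i} ∧ deg b = {j} ∧ φ a ≠ 1 ∧ φ b ≠ 1

variable {deg : M → Multiset I} {pr : I → M →* M} {φ : M →* G} {B : Submonoid M}

theorem IsPair.symm {w : Atom B} {i j : I} (h : IsPair deg φ w i j) : IsPair deg φ w j i := by
  obtain ⟨a, b, h1, h2, h3, h4, h5⟩ := h
  exact ⟨b, a, by rw [h1, mul_comm], h3, h2, h5, h4⟩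

theorem Admissible.symm {i j : I} (h : Admissible deg φ i j) : Admissible deg φ j i := by
  by_cases hij : i = j
  · subst hij; exact h
  · exact Or.inl (Ne.symm hij)

theorem not_admissible_iff {i j : I} :
    ¬ Admissible deg φ i j ↔ i = j ∧ HasEven deg φ i := by
  unfold Admissible
  tauto

namespace IsColoredKernel

variable [DecidableEq I] (h : IsColoredKernel deg pr φ B)
include h

theorem deg_one : deg (1 : M) = 0 := by
  have := h.deg_mul 1 1
  rw [mul_one] at this
  exact left_eq_add.1 this

theorem deg_pair {w : Atom B} {i j : I} (hw : IsPair deg φ w i j) :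
    deg (w.1 : M) = {i, j} := by
  obtain ⟨a, b, h1, h2, h3, -, -⟩ := hw
  rw [h1, h.deg_mul, h2, h3]
  rfl

theorem isUnit_iff (b : B) : IsUnit b ↔ deg (b : M) = 0 := by
  constructor
  · intro hb
    obtain ⟨c, hc⟩ := isUnit_iff_exists_inv.1 hb
    have := congrArg (fun t : B => deg (t : M)) hc
    simp only [Submonoid.coe_mul, Submonoid.coe_one, h.deg_mul, h.deg_one] at this
    exact eq_zero_of_add_right this
  · intro hb
    have : b = 1 := Subtype.ext (h.eq_one _ hb)
    rw [this]
    exact isUnit_one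

/-- An atom of `B` has no nontrivial divisor in `B`. -/
theorem irreducible_dvd (w : Atom B) {a b : M} (hw : (w.1 : M) = a * b) (ha : φ a = 1)
    (ha1 : deg a ≠ 0) : deg b = 0 := by
  have hφ : φ (w.1 : M) = 1 := (h.mem_iff _).1 w.1.2
  have hb : φ b = 1 := by
    rw [hw, map_mul, ha, one_mul] at hφ
    exact hφ
  have e : w.1 = (⟨a, (h.mem_iff _).2 ha⟩ : B) * ⟨b, (h.mem_iff _).2 hb⟩ := Subtype.ext hw
  rcases w.2.isUnit_or_isUnit e with h' | h'
  · exact absurd ((h.isUnit_iff _).1 h') ha1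
  · exact (h.isUnit_iff _).1 h'

/-- Split off a factor of degree one. If it is even, it is the whole atom. Otherwise the cofactor
contributes a second factor of degree one, which cannot be even either; the product of the two odd
factors lies in the kernel and exhausts the atom. -/
theorem single_or_pair (w : Atom B) :
    (∃ i, deg (w.1 : M) = {i}) ∨ ∃ i j, IsPair deg φ w i j := by
  have hw0 : deg (w.1 : M) ≠ 0 := fun h0 => w.2.not_isUnit ((h.isUnit_iff _).2 h0)
  obtain ⟨i, hi⟩ := Multiset.exists_mem_of_ne_zero hw0
  obtain ⟨u, hu, n, hn⟩ := h.exists_dvd _ _ hi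
  by_cases hφu : φ u = 1
  · left
    have := h.irreducible_dvd w hn hφu (by simp [hu])
    exact ⟨i, by rw [hn, h.deg_mul, this, hu, add_zero]⟩
  · right
    have hφ : φ (w.1 : M) = 1 := (h.mem_iff _).1 w.1.2
    have hn0 : deg n ≠ 0 := by
      intro h0
      rw [hn, h.eq_one n h0, mul_one] at hφ
      exact hφu hφ
    obtain ⟨j, hj⟩ := Multiset.exists_mem_of_ne_zero hn0
    obtain ⟨v, hv, m, hm⟩ := h.exists_dvd _ _ hj
    have hφv : φ v ≠ 1 := by
      intro h1
      have := h.irreducible_dvd w (a := v) (b := u * m)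
        (by rw [hn, hm, mul_left_comm]) h1 (by simp [hv])
      rw [h.deg_mul, hu] at this
      simp at this
    have := h.irreducible_dvd w (a := u * v) (b := m) (by rw [hn, hm, mul_assoc])
      (by rw [map_mul]; exact h.mul_eq_one _ _ hφu hφv) (by rw [h.deg_mul, hu]; simp)
    rw [h.eq_one m this, mul_one] at hm
    exact ⟨i, j, u, v, by rw [hn, hm], hu, hv, hφu, hφv⟩

theorem exists_mul_eq {a c e : M} {i : I} (ha : deg a = {i}) (hc : deg c = {i})
    (he : deg e = {i}) : ∃ f, deg f = {i} ∧ a * c = e * f := by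
  obtain ⟨f, hf⟩ := h.dvd (a * c) i e (by rw [h.deg_mul, ha, hc]; simp) he
  refine ⟨f, ?_, hf⟩
  have := congrArg deg hf
  rw [h.deg_mul, h.deg_mul, ha, hc, he] at this
  exact (add_left_cancel this).symm

/-- If both factors had color `i` and `e` were an even element of that color, the exchange property
would split off `e`, leaving a cofactor of degree `{i}`. -/
theorem isPair_admissible {w : Atom B} {i j : I} (hw : IsPair deg φ w i j) :
    Admissible deg φ i j := by
  by_contra hcon
  rw [not_admissible_iff] at hcon
  obtain ⟨rfl, e, he, hφe⟩ := hcon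
  obtain ⟨a, b, h1, h2, h3, h4, h5⟩ := hw
  obtain ⟨f, hf, hfe⟩ := h.exists_mul_eq h2 h3 he
  have := h.irreducible_dvd w (h1.trans hfe) hφe (by simp [he])
  simp [hf] at this

theorem exists_single {e : M} {i : I} (he : deg e = {i}) (hφ : φ e = 1) :
    ∃ w : Atom B, (w.1 : M) = e := by
  refine ⟨⟨⟨e, (h.mem_iff _).2 hφ⟩, ?_, ?_⟩, rfl⟩
  · rw [h.isUnit_iff]
    simp [he]
  · intro s t hst
    have := congrArg (fun b : B => deg (b : M)) hst
    simp only [Submonoid.coe_mul, h.deg_mul, he] at this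
    rw [h.isUnit_iff, h.isUnit_iff]
    have hc := congrArg Multiset.card this
    rw [Multiset.card_add, Multiset.card_singleton] at hc
    rw [← Multiset.card_eq_zero, ← Multiset.card_eq_zero]
    omega

theorem exists_pair {a b : M} {i j : I} (ha : deg a = {i}) (hb : deg b = {j})
    (hφa : φ a ≠ 1) (hφb : φ b ≠ 1) (hadm : Admissible deg φ i j) :
    ∃ w : Atom B, (w.1 : M) = a * b := by
  have hφ : φ (a * b) = 1 := by rw [map_mul]; exact h.mul_eq_one _ _ hφa hφb
  refine ⟨⟨⟨a * b, (h.mem_iff _).2 hφ⟩, ?_, ?_⟩, rfl⟩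
  · rw [h.isUnit_iff, h.deg_mul, ha]
    simp
  · intro s t hst
    have hM : a * b = s * t := congrArg (fun b : B => (b : M)) hst
    have hd : ({i} : Multiset I) + {j} = deg (s : M) + deg (t : M) := by
      rw [← h.deg_mul, ← hM, h.deg_mul, ha, hb]
    have hc := congrArg Multiset.card hd
    simp only [Multiset.card_add, Multiset.card_singleton] at hc
    rw [h.isUnit_iff, h.isUnit_iff, ← Multiset.card_eq_zero, ← Multiset.card_eq_zero]
    by_contra hcon
    push Not at hcon
    obtain ⟨k, hk⟩ := Multiset.card_eq_one.1 (show Multiset.card (deg (s : M)) = 1 by omega)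
    obtain ⟨l, hl⟩ := Multiset.card_eq_one.1 (show Multiset.card (deg (t : M)) = 1 by omega)
    have hφs : φ (s : M) = 1 := (h.mem_iff _).1 s.2
    have hφt : φ (t : M) = 1 := (h.mem_iff _).1 t.2
    rw [hk, hl] at hd
    have hkl : (k = i ∧ l = j) ∨ (k = j ∧ l = i) := by
      have h1 : k ∈ ({i} : Multiset I) + {j} := by rw [hd]; simp
      simp only [Multiset.mem_add, Multiset.mem_singleton] at h1
      rcases h1 with rfl | rfl
      · exact Or.inl ⟨rfl, by simpa using (add_left_cancel hd).symm⟩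
      · rw [add_comm] at hd
        exact Or.inr ⟨rfl, by simpa using (add_left_cancel hd).symm⟩
    by_cases hij : i = j
    · subst hij
      rcases hadm with hne | hne
      · exact hne rfl
      · obtain rfl : k = i := by tauto
        exact hne ⟨s, hk, hφs⟩
    -- For `i ≠ j` the component of color `i` of the product is unique, so a decomposition in the
    -- kernel would make the odd factor `a` even.
    · have p1 := congrArg (pr i) hM
      rw [map_mul, map_mul, h.pr_self i a (by simp [ha]), h.pr_eq_one i b (by simpa [hb] using hij),
        mul_one] at p1
      rcases hkl with ⟨rfl, rfl⟩ | ⟨rfl, rfl⟩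
      · rw [h.pr_self _ _ (by simp [hk]), h.pr_eq_one _ (t : M) (by simpa [hl] using hij),
          mul_one] at p1
        exact hφa (p1 ▸ hφs)
      · rw [h.pr_self _ (t : M) (by simp [hl]), h.pr_eq_one _ (s : M) (by simpa [hk] using hij),
          one_mul] at p1
        exact hφa (p1 ▸ hφt)

theorem exists_even_mul {a c : M} {i : I} (ha : deg a = {i}) (hc : deg c = {i})
    (hφa : φ a ≠ 1) (hφc : φ c ≠ 1) (hi : HasEven deg φ i) :
    ∃ w w' : Atom B, deg (w.1 : M) = {i} ∧ deg (w'.1 : M) = {i} ∧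
      a * c = (w.1 : M) * w'.1 := by
  obtain ⟨e, he, hφe⟩ := hi
  obtain ⟨f, hf, hef⟩ := h.exists_mul_eq ha hc he
  have hφf : φ f = 1 := by
    have := congrArg φ hef
    rwa [map_mul, map_mul, hφe, one_mul, h.mul_eq_one _ _ hφa hφc, eq_comm] at this
  obtain ⟨w, rfl⟩ := h.exists_single he hφe
  obtain ⟨w', rfl⟩ := h.exists_single hf hφf
  exact ⟨w, w', he, hf, hef⟩

theorem exists_odd_mul {a c e : M} {i : I} (ha : deg a = {i}) (hc : deg c = {i})
    (hφa : φ a = 1) (hφc : φ c = 1) (he : deg e = {i}) (hφe : φ e ≠ 1) :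
    ∃ f, deg f = {i} ∧ φ f ≠ 1 ∧ a * c = e * f := by
  obtain ⟨f, hf, hef⟩ := h.exists_mul_eq ha hc he
  refine ⟨f, hf, ?_, hef⟩
  intro hφf
  have := congrArg φ hef
  rw [map_mul, map_mul, hφa, hφc, hφf, one_mul, mul_one] at this
  exact hφe this.symm

theorem eq_of_ne_one {g k : G} (hg : g ≠ 1) (hk : k ≠ 1) : g = k := by
  have h1 := h.mul_eq_one g k hg hk
  have h2 := h.mul_eq_one k k hk hk
  exact mul_right_cancel (h1.trans h2.symm)

/-- In an atom, the factor of color `i` may be replaced by a factor of the same color in the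
same class. -/
theorem exists_replaceable (w : Atom B) {i : I} (hi : i ∈ deg (w.1 : M)) :
    ∃ c s : M, deg c = {i} ∧ (w.1 : M) = c * s ∧
      (∀ c', deg c' = {i} → φ c' = φ c → ∃ w' : Atom B, (w'.1 : M) = c' * s) := by
  have hφw : φ (w.1 : M) = 1 := (h.mem_iff _).1 w.1.2
  have key : ∀ j, IsPair deg φ w i j → ∃ c s : M, deg c = {i} ∧ (w.1 : M) = c * s ∧
      (∀ c', deg c' = {i} → φ c' = φ c → ∃ w' : Atom B, (w'.1 : M) = c' * s) := by
    intro j hw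
    have hadm := h.isPair_admissible hw
    obtain ⟨a, b, h1, h2, h3, h4, h5⟩ := hw
    exact ⟨a, b, h2, h1, fun c' hc' hφ => h.exists_pair hc' h3 (hφ ▸ h4) h5 hadm⟩
  rcases h.single_or_pair w with ⟨j, hj⟩ | ⟨j, k, hw⟩
  · rw [hj, Multiset.mem_singleton] at hi
    subst hi
    refine ⟨w.1, 1, hj, (mul_one _).symm, fun c' hc' hφ => ?_⟩
    rw [mul_one]
    exact h.exists_single hc' (hφ.trans hφw)
  · have hd := h.deg_pair hw
    rw [hd] at hi
    simp only [Multiset.insert_eq_cons, Multiset.mem_cons, Multiset.mem_singleton] at hi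
    rcases hi with rfl | rfl
    · exact key _ hw
    · exact key _ hw.symm

theorem pair_of_mem {w : Atom B} {i : I} (hi : i ∈ deg (w.1 : M))
    (hc : Multiset.card (deg (w.1 : M)) = 2) : ∃ u, IsPair deg φ w i u := by
  rcases h.single_or_pair w with ⟨j, hj⟩ | ⟨j, k, hw⟩
  · simp [hj] at hc
  · have hd := h.deg_pair hw
    rw [hd] at hi
    simp only [Multiset.insert_eq_cons, Multiset.mem_cons, Multiset.mem_singleton] at hi
    rcases hi with rfl | rfl
    · exact ⟨_, hw⟩
    · exact ⟨_, hw.symm⟩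

end IsColoredKernel

end ColoredModel

/-! ### Moves on factorizations that leave at least one atom fixed. -/

section Moves

variable {M I G : Type*} [CommMonoid M] [CommGroup G]
variable {deg : M → Multiset I} {pr : I → M →* M} {φ : M →* G} {B : Submonoid M}

theorem MonotoneRChain.replace_of_card_lt {x A A' R : FactMonoid B} (hx : x = A + R)
    (hA : Multiset.card A < Multiset.card x) (h : ((factProd A : B) : M) = (factProd A' : B))
    (hc : Multiset.card A ≤ Multiset.card A') : MonotoneRChain x (A' + R) := by
  subst hx
  refine MonotoneRChain.replace ?_ (Subtype.ext h) hc
  rintro rfl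
  simp at hA

theorem MonotoneRChain.refl_of_ne_zero {x : FactMonoid B} (hx : x ≠ 0) : MonotoneRChain x x := by
  obtain ⟨u, hu⟩ := Multiset.exists_mem_of_ne_zero hx
  exact MonotoneRChain.of_common hu hu rfl le_rfl

namespace IsColoredKernel

variable [DecidableEq I] (h : IsColoredKernel deg pr φ B)
include h

theorem mem_deg_factProd {x : FactMonoid B} {i : I} :
    i ∈ deg ((factProd x : B) : M) ↔ ∃ w ∈ x, i ∈ deg (w.1 : M) := by
  induction x using Multiset.induction with
  | empty => simp [h.deg_one]
  | cons w x ih => simp [h.deg_mul, ih]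

/-- The factor `a` of `w` is exchanged against a factor `c` of the same color in another atom, via
`a * c = a' * c'`. As `a` and `a'` have the same class, so have `c` and `c'`, and the other atom
remains an atom. Only two atoms change, which is why length three suffices. -/
theorem replace_factor {x : FactMonoid B} (hx3 : 3 ≤ Multiset.card x) {w v : Atom B}
    (hw : w ∈ x) {i : I} {a a' s : M} (hwa : (w.1 : M) = a * s) (hva : (v.1 : M) = a' * s)
    (ha : deg a = {i}) (ha' : deg a' = {i}) (hs : i ∉ deg s) (hφ : φ a' = φ a)
    (hdvd : a' ∣ ((factProd x : B) : M)) :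
    ∃ z, MonotoneRChain x z ∧ Multiset.card z = Multiset.card x ∧ v ∈ z := by
  by_cases haa : a = a'
  · subst haa
    obtain rfl : v = w := Subtype.ext (Subtype.ext (hva.trans hwa.symm))
    refine ⟨x, MonotoneRChain.refl_of_ne_zero ?_, rfl, hw⟩
    rintro rfl
    simp at hw
  obtain ⟨x', rfl⟩ := Multiset.exists_cons_of_mem hw
  -- If color `i` occurred nowhere else in `x`, projecting to that component would give `a = a'`.
  have hi : i ∈ deg ((factProd x' : B) : M) := by
    by_contra hcon
    apply haa
    obtain ⟨n, hn⟩ := hdvd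
    rw [factProd_cons, Submonoid.coe_mul, hwa] at hn
    have hdn : deg s + deg ((factProd x' : B) : M) = deg n := by
      have := congrArg deg hn
      rw [h.deg_mul, h.deg_mul, h.deg_mul, ha, ha', add_assoc] at this
      exact add_left_cancel this
    have hin : i ∉ deg n := by
      rw [← hdn, Multiset.mem_add]
      tauto
    have := congrArg (pr i) hn
    rwa [map_mul, map_mul, map_mul, h.pr_self i a (by simp [ha]), h.pr_eq_one i s hs,
      h.pr_eq_one _ _ hcon, h.pr_self i a' (by simp [ha']), h.pr_eq_one _ _ hin, mul_one, mul_one,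
      mul_one] at this
  obtain ⟨w', hw', hiw'⟩ := h.mem_deg_factProd.1 hi
  obtain ⟨R, rfl⟩ := Multiset.exists_cons_of_mem hw'
  obtain ⟨c, t, hc, hct, hrep⟩ := h.exists_replaceable w' hiw'
  obtain ⟨c', hc', hac⟩ := h.exists_mul_eq ha hc ha'
  have hφc : φ c' = φ c := by
    have := congrArg φ hac
    rw [map_mul, map_mul, hφ] at this
    exact (mul_left_cancel this).symm
  obtain ⟨v', hv'⟩ := hrep c' hc' hφc
  refine ⟨{v, v'} + R, MonotoneRChain.replace_of_card_lt (A := {w, w'}) ?_ ?_ ?_ ?_, ?_, ?_⟩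
  · simp
  · simp only [Multiset.insert_eq_cons, Multiset.card_cons, Multiset.card_singleton] at hx3 ⊢
    omega
  · simp only [Multiset.insert_eq_cons, factProd_cons, factProd_singleton, Submonoid.coe_mul, hwa, hct, hva,
      hv']
    rw [mul_mul_mul_comm, hac, mul_mul_mul_comm]
  · simp
  · simp
  · simp

/-- A single, or a pair with distinct colors, is adjusted one factor at a time. In a pair `(i i)`
both factors are exchanged at once, with the help of one further atom containing color `i`. -/
theorem exists_chain_mem {x y : FactMonoid B} (hxy : factProd x = factProd y)
    (hx3 : 3 ≤ Multiset.card x) {w v : Atom B} (hw : w ∈ x) (hv : v ∈ y)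
    (hd : deg (w.1 : M) = deg (v.1 : M)) :
    ∃ z, MonotoneRChain x z ∧ Multiset.card z = Multiset.card x ∧ v ∈ z := by
  have hvx : (v.1 : M) ∣ ((factProd x : B) : M) := by
    rw [hxy]
    obtain ⟨y', rfl⟩ := Multiset.exists_cons_of_mem hv
    exact ⟨((factProd y' : B) : M), by simp⟩
  rcases h.single_or_pair v with ⟨i, hi⟩ | ⟨i, j, hp⟩
  · have hφw : φ (w.1 : M) = 1 := (h.mem_iff _).1 w.1.2
    have hφv : φ (v.1 : M) = 1 := (h.mem_iff _).1 v.1.2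
    exact h.replace_factor hx3 hw (mul_one _).symm (mul_one _).symm (hd.trans hi) hi
      (by simp [h.deg_one]) (hφv.trans hφw.symm) hvx
  · have hdv := h.deg_pair hp
    have hadm := h.isPair_admissible hp
    obtain ⟨u, hpw⟩ := h.pair_of_mem (w := w) (i := i) (by simp [hd, hdv]) (by simp [hd, hdv])
    obtain rfl : u = j := by
      have := h.deg_pair hpw
      rw [hd, hdv] at this
      simpa using this.symm
    obtain ⟨a, b, hwab, ha, hb, hφa, hφb⟩ := hpw
    obtain ⟨a', b', hvab, ha', hb', hφa', hφb'⟩ := hp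
    by_cases hij : i = u
    · subst hij
      by_cases hwv : w = v
      · subst hwv
        refine ⟨x, MonotoneRChain.refl_of_ne_zero ?_, rfl, hw⟩
        rintro rfl
        simp at hw
      obtain ⟨x', rfl⟩ := Multiset.exists_cons_of_mem hw
      obtain ⟨y', rfl⟩ := Multiset.exists_cons_of_mem hv
      have hM : (w.1 : M) * ((factProd x' : B) : M) = (v.1 : M) * ((factProd y' : B) : M) := by
        have := congrArg (fun t : B => (t : M)) hxy
        simpa using this
      have hdeg : deg ((factProd x' : B) : M) = deg ((factProd y' : B) : M) := by
        have := congrArg deg hM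
        rw [h.deg_mul, h.deg_mul, hd] at this
        exact add_left_cancel this
      have hi : i ∈ deg ((factProd x' : B) : M) := by
        by_contra hcon
        apply hwv
        have := congrArg (pr i) hM
        rw [map_mul, map_mul, h.pr_self i (w.1 : M) (by simp [hd, hdv]),
          h.pr_self i (v.1 : M) (by simp [hdv]), h.pr_eq_one _ _ hcon,
          h.pr_eq_one _ _ (hdeg ▸ hcon), mul_one, mul_one] at this
        exact Subtype.ext (Subtype.ext this)
      obtain ⟨w', hw', hiw'⟩ := h.mem_deg_factProd.1 hi
      obtain ⟨R, rfl⟩ := Multiset.exists_cons_of_mem hw'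
      obtain ⟨c, t, hc, hct, hrep⟩ := h.exists_replaceable w' hiw'
      obtain ⟨c1, hc1, hbc⟩ := h.exists_mul_eq hb hc hb'
      obtain ⟨c2, hc2, hac⟩ := h.exists_mul_eq ha hc1 ha'
      -- A pair `(i i)` is admissible only when color `i` has no even element, so the leftover
      -- factor `c2` has the same class as `c`.
      have hodd : ∀ e, deg e = {i} → φ e ≠ 1 := by
        intro e he hφe
        rcases hadm with hne | hne
        · exact hne rfl
        · exact hne ⟨e, he, hφe⟩
      obtain ⟨v', hv'⟩ := hrep c2 hc2 (h.eq_of_ne_one (hodd _ hc2) (hodd _ hc))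
      refine ⟨{v, v'} + R, MonotoneRChain.replace_of_card_lt (A := {w, w'}) ?_ ?_ ?_ ?_, ?_, ?_⟩
      · simp
      · simp only [Multiset.insert_eq_cons, Multiset.card_cons, Multiset.card_singleton] at hx3 ⊢
        omega
      · simp only [Multiset.insert_eq_cons, factProd_cons, factProd_singleton, Submonoid.coe_mul, hwab, hct,
          hvab, hv']
        calc a * b * (c * t) = a * (b * c) * t := by ac_rfl
          _ = (a * c1) * b' * t := by rw [hbc]; ac_rfl
          _ = a' * b' * (c2 * t) := by rw [hac]; ac_rfl
      · simp
      · simp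
      · simp
    · obtain ⟨w₁, hw₁⟩ := h.exists_pair ha' hb hφa' hφb hadm
      obtain ⟨z, hz, hzc, hzm⟩ := h.replace_factor hx3 hw hwab hw₁ ha ha'
        (by simpa [hb] using hij) (h.eq_of_ne_one hφa' hφa)
        ((Dvd.intro _ hvab.symm).trans hvx)
      obtain ⟨z', hz', hzc', hzm'⟩ := h.replace_factor (hzc ▸ hx3) hzm
        (hw₁.trans (mul_comm _ _)) (hvab.trans (mul_comm _ _)) hb hb'
        (by simpa [ha'] using Ne.symm hij) (h.eq_of_ne_one hφb' hφb)
        (by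
          rw [← hz.factProd_eq]
          exact (Dvd.intro_left _ hvab.symm).trans hvx)
      exact ⟨z', hz.trans hz', hzc'.trans hzc, hzm'⟩

theorem chain_of_common_deg {x y : FactMonoid B} (hxy : factProd x = factProd y)
    (hx3 : 3 ≤ Multiset.card x) (hc : Multiset.card x ≤ Multiset.card y) {w v : Atom B}
    (hw : w ∈ x) (hv : v ∈ y) (hd : deg (w.1 : M) = deg (v.1 : M)) : MonotoneRChain x y := by
  obtain ⟨z, hz, hzc, hzm⟩ := h.exists_chain_mem hxy hx3 hw hv hd
  exact hz.trans (MonotoneRChain.of_common hzm hv (hz.factProd_eq.symm.trans hxy)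
    (by omega))

/-- `(c a)(d b) = (c d)(a b)` -/
theorem swap_pairs {x R : FactMonoid B} {p p' : Atom B} {a b c d : I}
    (hx : x = p ::ₘ p' ::ₘ R) (hx3 : 3 ≤ Multiset.card x) (hp : IsPair deg φ p c a)
    (hp' : IsPair deg φ p' d b) (hcd : Admissible deg φ c d) (hab : Admissible deg φ a b) :
    ∃ z, MonotoneRChain x z ∧ Multiset.card z = Multiset.card x ∧
      ∃ w ∈ z, deg (w.1 : M) = {c, d} := by
  obtain ⟨γ, α, h1, hγ, hα, hφγ, hφα⟩ := hp
  obtain ⟨δ, β, h2, hδ, hβ, hφδ, hφβ⟩ := hp'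
  obtain ⟨v, hv⟩ := h.exists_pair hγ hδ hφγ hφδ hcd
  obtain ⟨v', hv'⟩ := h.exists_pair hα hβ hφα hφβ hab
  subst hx
  refine ⟨{v, v'} + R, MonotoneRChain.replace_of_card_lt (A := {p, p'}) ?_ ?_ ?_ ?_, ?_,
    v, by simp, ?_⟩
  · simp
  · simp only [Multiset.insert_eq_cons, Multiset.card_cons, Multiset.card_singleton] at hx3 ⊢
    omega
  · simp only [Multiset.insert_eq_cons, factProd_cons, factProd_singleton, Submonoid.coe_mul, h1, h2, hv,
      hv']
    rw [mul_mul_mul_comm]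
  · simp
  · simp
  · rw [hv, h.deg_mul, hγ, hδ]; rfl

/-- `(i u)(i v) = (i)(i)(u v)` -/
theorem split_pairs {x R : FactMonoid B} {p p' : Atom B} {i u v : I}
    (hx : x = p ::ₘ p' ::ₘ R) (hx3 : 3 ≤ Multiset.card x) (hp : IsPair deg φ p i u)
    (hp' : IsPair deg φ p' i v) (hi : HasEven deg φ i) (huv : Admissible deg φ u v) :
    ∃ z, MonotoneRChain x z ∧ Multiset.card z = Multiset.card x + 1 ∧
      ∃ w ∈ z, deg (w.1 : M) = {i} := by
  obtain ⟨γ, α, h1, hγ, hα, hφγ, hφα⟩ := hp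
  obtain ⟨δ, β, h2, hδ, hβ, hφδ, hφβ⟩ := hp'
  obtain ⟨s, s', hs, hs', hss⟩ := h.exists_even_mul hγ hδ hφγ hφδ hi
  obtain ⟨v', hv'⟩ := h.exists_pair hα hβ hφα hφβ huv
  subst hx
  refine ⟨{s, s', v'} + R, MonotoneRChain.replace_of_card_lt (A := {p, p'}) ?_ ?_ ?_ ?_, ?_,
    s, by simp, hs⟩
  · simp
  · simp only [Multiset.insert_eq_cons, Multiset.card_cons, Multiset.card_singleton] at hx3 ⊢
    omega
  · simp only [Multiset.insert_eq_cons, factProd_cons, factProd_singleton, Submonoid.coe_mul, h1, h2,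
      hv']
    rw [mul_mul_mul_comm, hss, mul_assoc]
  · simp
  · simp

/-- `(i j)(i j) = (i)(i)(j)(j)` -/
theorem split_pairs_two {x R : FactMonoid B} {p p' : Atom B} {i j : I}
    (hx : x = p ::ₘ p' ::ₘ R) (hx3 : 3 ≤ Multiset.card x) (hp : IsPair deg φ p i j)
    (hp' : IsPair deg φ p' i j) (hi : HasEven deg φ i) (hj : HasEven deg φ j) :
    ∃ z, MonotoneRChain x z ∧ Multiset.card z = Multiset.card x + 2 ∧
      ∃ w ∈ z, deg (w.1 : M) = {i} := by
  obtain ⟨γ, α, h1, hγ, hα, hφγ, hφα⟩ := hp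
  obtain ⟨δ, β, h2, hδ, hβ, hφδ, hφβ⟩ := hp'
  obtain ⟨s, s', hs, hs', hss⟩ := h.exists_even_mul hγ hδ hφγ hφδ hi
  obtain ⟨t, t', ht, ht', htt⟩ := h.exists_even_mul hα hβ hφα hφβ hj
  subst hx
  refine ⟨{s, s', t, t'} + R, MonotoneRChain.replace_of_card_lt (A := {p, p'}) ?_ ?_ ?_ ?_, ?_,
    s, by simp, hs⟩
  · simp
  · simp only [Multiset.insert_eq_cons, Multiset.card_cons, Multiset.card_singleton] at hx3 ⊢
    omega
  · simp only [Multiset.insert_eq_cons, factProd_cons, factProd_singleton, Submonoid.coe_mul, h1, h2]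
    rw [mul_mul_mul_comm, hss, htt, mul_assoc]
  · simp
  · simp

/-- `(i j)(i j)(a b) = (i)(i)(j a)(j b)` -/
theorem split_pairs_of_pair {x R : FactMonoid B} {p p' q : Atom B} {i j a b : I}
    (hx : x = p ::ₘ p' ::ₘ q ::ₘ R) (hx4 : 4 ≤ Multiset.card x) (hp : IsPair deg φ p i j)
    (hp' : IsPair deg φ p' i j) (hq : IsPair deg φ q a b) (hi : HasEven deg φ i)
    (hja : Admissible deg φ j a) (hjb : Admissible deg φ j b) :
    ∃ z, MonotoneRChain x z ∧ Multiset.card z = Multiset.card x + 1 ∧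
      ∃ w ∈ z, deg (w.1 : M) = {i} := by
  obtain ⟨γ, α, h1, hγ, hα, hφγ, hφα⟩ := hp
  obtain ⟨δ, β, h2, hδ, hβ, hφδ, hφβ⟩ := hp'
  obtain ⟨ζ, η, h3, hζ, hη, hφζ, hφη⟩ := hq
  obtain ⟨s, s', hs, hs', hss⟩ := h.exists_even_mul hγ hδ hφγ hφδ hi
  obtain ⟨v, hv⟩ := h.exists_pair hα hζ hφα hφζ hja
  obtain ⟨v', hv'⟩ := h.exists_pair hβ hη hφβ hφη hjb
  subst hx
  refine ⟨{s, s', v, v'} + R, MonotoneRChain.replace_of_card_lt (A := {p, p', q}) ?_ ?_ ?_ ?_, ?_,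
    s, by simp, hs⟩
  · simp
  · simp only [Multiset.insert_eq_cons, Multiset.card_cons, Multiset.card_singleton] at hx4 ⊢
    omega
  · simp only [Multiset.insert_eq_cons, factProd_cons, factProd_singleton, Submonoid.coe_mul, h1, h2, h3,
      hv, hv']
    calc γ * α * (δ * β * (ζ * η)) = γ * δ * (α * ζ * (β * η)) := by ac_rfl
      _ = _ := by rw [hss, mul_assoc]
  · simp
  · simp

/-- `(i u)(i v)(l)(l) = (i)(i)(l u)(l v)` -/
theorem exchange_pairs {x R : FactMonoid B} {p p' q q' : Atom B} {i u v l : I}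
    (hx : x = p ::ₘ p' ::ₘ q ::ₘ q' ::ₘ R) (hx5 : 5 ≤ Multiset.card x) (hp : IsPair deg φ p i u)
    (hp' : IsPair deg φ p' i v) (hq : deg (q.1 : M) = {l}) (hq' : deg (q'.1 : M) = {l})
    (hi : HasEven deg φ i) (hl : ∃ e, deg e = {l} ∧ φ e ≠ 1)
    (hlu : l ≠ u) (hlv : l ≠ v) :
    ∃ z, MonotoneRChain x z ∧ Multiset.card z = Multiset.card x ∧
      ∃ w ∈ z, deg (w.1 : M) = {i} := by
  obtain ⟨γ, α, h1, hγ, hα, hφγ, hφα⟩ := hp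
  obtain ⟨δ, β, h2, hδ, hβ, hφδ, hφβ⟩ := hp'
  obtain ⟨s, s', hs, hs', hss⟩ := h.exists_even_mul hγ hδ hφγ hφδ hi
  obtain ⟨e, he, hφe⟩ := hl
  obtain ⟨f, hf, hφf, hef⟩ := h.exists_odd_mul hq hq' ((h.mem_iff _).1 q.1.2)
    ((h.mem_iff _).1 q'.1.2) he hφe
  obtain ⟨v, hv⟩ := h.exists_pair he hα hφe hφα (Or.inl hlu)
  obtain ⟨v', hv'⟩ := h.exists_pair hf hβ hφf hφβ (Or.inl hlv)
  subst hx
  refine ⟨{s, s', v, v'} + R, MonotoneRChain.replace_of_card_lt (A := {p, p', q, q'}) ?_ ?_ ?_ ?_,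
    ?_, s, by simp, hs⟩
  · simp
  · simp only [Multiset.insert_eq_cons, Multiset.card_cons, Multiset.card_singleton] at hx5 ⊢
    omega
  · simp only [Multiset.insert_eq_cons, factProd_cons, factProd_singleton, Submonoid.coe_mul, h1, h2,
      hv, hv']
    calc γ * α * (δ * β * ((q.1 : M) * q'.1)) = γ * δ * (((q.1 : M) * q'.1) * (α * β)) := by ac_rfl
      _ = _ := by rw [hss, hef, mul_mul_mul_comm e, mul_assoc]
  · simp
  · simp

end IsColoredKernel

end Moves

theorem exists_eq_cons_cons {α : Type*} {s : Multiset α} {a b : α} (ha : a ∈ s) (hb : b ∈ s)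
    (hab : a ≠ b) : ∃ t, s = a ::ₘ b ::ₘ t := by
  obtain ⟨s', rfl⟩ := Multiset.exists_cons_of_mem ha
  rw [Multiset.mem_cons] at hb
  obtain ⟨t, rfl⟩ := Multiset.exists_cons_of_mem (hb.resolve_left (Ne.symm hab))
  exact ⟨t, rfl⟩

theorem card_eq_count_add_count {α : Type*} [DecidableEq α] {s : Multiset α} {a b : α}
    (hab : a ≠ b) (hs : ∀ c ∈ s, c = a ∨ c = b) : Multiset.card s = s.count a + s.count b := by
  induction s using Multiset.induction with
  | empty => simp
  | cons c s ih =>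
    have := ih fun d hd => hs d (Multiset.mem_cons_of_mem hd)
    rcases hs c (Multiset.mem_cons_self c s) with rfl | rfl
    · simp [Multiset.count_cons_of_ne (Ne.symm hab), this]
      omega
    · simp [Multiset.count_cons_of_ne hab, this]
      omega

/-! ### Color counts of singles and pairs, and the construction of the chains. -/

section OddPart

variable {M I G : Type*} [CommMonoid M] [CommGroup G]
variable {B : Submonoid M}

/-- The multiset of colors occurring in the atoms of degree two of a factorization. -/
def oddPart (deg : M → Multiset I) (x : FactMonoid B) : Multiset I :=
  (x.map fun w => if Multiset.card (deg (w.1 : M)) = 2 then deg (w.1 : M) else 0).sum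

/-- The multiset of colors occurring in the other atoms of a factorization. -/
def evenPart (deg : M → Multiset I) (x : FactMonoid B) : Multiset I :=
  (x.map fun w => if Multiset.card (deg (w.1 : M)) = 2 then 0 else deg (w.1 : M)).sum

/-- The number of atoms of degree two in a factorization. -/
def numPairs (deg : M → Multiset I) (x : FactMonoid B) : ℕ :=
  (x.map fun w => if Multiset.card (deg (w.1 : M)) = 2 then 1 else 0).sum

variable {deg : M → Multiset I} {pr : I → M →* M} {φ : M →* G}

@[simp]
theorem oddPart_zero : oddPart deg (0 : FactMonoid B) = 0 := rfl

@[simp]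
theorem evenPart_zero : evenPart deg (0 : FactMonoid B) = 0 := rfl

@[simp]
theorem numPairs_zero : numPairs deg (0 : FactMonoid B) = 0 := rfl

theorem oddPart_cons (w : Atom B) (x : FactMonoid B) : oddPart deg (w ::ₘ x) =
    (if Multiset.card (deg (w.1 : M)) = 2 then deg (w.1 : M) else 0) + oddPart deg x := by
  simp [oddPart]

theorem evenPart_cons (w : Atom B) (x : FactMonoid B) : evenPart deg (w ::ₘ x) =
    (if Multiset.card (deg (w.1 : M)) = 2 then 0 else deg (w.1 : M)) + evenPart deg x := by
  simp [evenPart]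

theorem numPairs_cons (w : Atom B) (x : FactMonoid B) : numPairs deg (w ::ₘ x) =
    (if Multiset.card (deg (w.1 : M)) = 2 then 1 else 0) + numPairs deg x := by
  simp [numPairs]

theorem card_oddPart (x : FactMonoid B) :
    Multiset.card (oddPart deg x) = 2 * numPairs deg x := by
  induction x using Multiset.induction with
  | empty => simp
  | cons w x ih =>
    rw [oddPart_cons, numPairs_cons, Multiset.card_add, ih]
    split_ifs with h2
    · omega
    · simp

theorem mem_evenPart_of_deg_eq {x : FactMonoid B} {i : I} {w : Atom B} (hw : w ∈ x)
    (hi : deg (w.1 : M) = {i}) : i ∈ evenPart deg x := by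
  obtain ⟨x', rfl⟩ := Multiset.exists_cons_of_mem hw
  rw [evenPart_cons, hi]
  simp

namespace IsColoredKernel

variable [DecidableEq I] (h : IsColoredKernel deg pr φ B)
include h

theorem evenPart_add_oddPart (x : FactMonoid B) :
    evenPart deg x + oddPart deg x = deg ((factProd x : B) : M) := by
  induction x using Multiset.induction with
  | empty => simp [h.deg_one]
  | cons w x ih =>
    rw [oddPart_cons, evenPart_cons, factProd_cons, Submonoid.coe_mul, h.deg_mul, ← ih]
    split_ifs
    · rw [zero_add, add_left_comm]
    · rw [zero_add, add_assoc]

theorem card_deg (w : Atom B) :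
    Multiset.card (deg (w.1 : M)) = 1 ∨ Multiset.card (deg (w.1 : M)) = 2 := by
  rcases h.single_or_pair w with ⟨i, hi⟩ | ⟨i, j, hp⟩
  · simp [hi]
  · simp [h.deg_pair hp]

theorem card_evenPart_add_numPairs (x : FactMonoid B) :
    Multiset.card (evenPart deg x) + numPairs deg x = Multiset.card x := by
  induction x using Multiset.induction with
  | empty => simp
  | cons w x ih =>
    rw [evenPart_cons, numPairs_cons, Multiset.card_add, Multiset.card_cons, ← ih]
    have := h.card_deg w
    split_ifs with h2
    · simp only [Multiset.card_zero]
      omega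
    · omega

/-- Singles have degree one and pairs degree two. Hence, among factorizations of one element, a
longer one has correspondingly fewer pairs. -/
theorem card_add_numPairs (x : FactMonoid B) : Multiset.card x + numPairs deg x =
    Multiset.card (deg ((factProd x : B) : M)) := by
  rw [← h.evenPart_add_oddPart, Multiset.card_add, card_oddPart, ← h.card_evenPart_add_numPairs]
  omega

theorem exists_single_of_mem_evenPart {x : FactMonoid B} {i : I} (hi : i ∈ evenPart deg x) :
    ∃ w ∈ x, deg (w.1 : M) = {i} := by
  induction x using Multiset.induction with
  | empty => simp at hi
  | cons w x ih =>
    rw [evenPart_cons, Multiset.mem_add] at hi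
    rcases hi with hi | hi
    · split_ifs at hi with h2
      · simp at hi
      · have h1 := (h.card_deg w).resolve_right h2
        obtain ⟨j, hj⟩ := Multiset.card_eq_one.1 h1
        rw [hj, Multiset.mem_singleton] at hi
        subst hi
        exact ⟨w, by simp, hj⟩
    · obtain ⟨w', hw', hd⟩ := ih hi
      exact ⟨w', by simp [hw'], hd⟩

theorem exists_singles {x : FactMonoid B} {i : I} (hi : 2 ≤ (evenPart deg x).count i) :
    ∃ w w' R, x = w ::ₘ w' ::ₘ R ∧ deg (w.1 : M) = {i} ∧ deg (w'.1 : M) = {i} := by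
  obtain ⟨w, hw, hd⟩ := h.exists_single_of_mem_evenPart
    (Multiset.count_pos.1 (show 0 < (evenPart deg x).count i by omega))
  obtain ⟨x', rfl⟩ := Multiset.exists_cons_of_mem hw
  rw [evenPart_cons, hd] at hi
  simp only [Multiset.card_singleton, OfNat.one_ne_ofNat, ↓reduceIte, Multiset.count_add,
    Multiset.count_singleton_self] at hi
  obtain ⟨w', hw', hd'⟩ := h.exists_single_of_mem_evenPart
    (Multiset.count_pos.1 (show 0 < (evenPart deg x').count i by omega))
  obtain ⟨R, rfl⟩ := Multiset.exists_cons_of_mem hw'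
  exact ⟨w, w', R, rfl, hd, hd'⟩

theorem exists_pair_of_mem_oddPart {x : FactMonoid B} {i : I} (hi : i ∈ oddPart deg x) :
    ∃ w ∈ x, ∃ u, IsPair deg φ w i u := by
  induction x using Multiset.induction with
  | empty => simp at hi
  | cons w x ih =>
    rw [oddPart_cons, Multiset.mem_add] at hi
    rcases hi with hi | hi
    · split_ifs at hi with h2
      · exact ⟨w, by simp, h.pair_of_mem hi h2⟩
      · simp at hi
    · obtain ⟨w', hw', hd⟩ := ih hi
      exact ⟨w', by simp [hw'], hd⟩

theorem oddPart_cons_pair {w : Atom B} {i j : I} (hw : IsPair deg φ w i j) (x : FactMonoid B) :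
    oddPart deg (w ::ₘ x) = {i, j} + oddPart deg x := by
  rw [oddPart_cons, h.deg_pair hw]
  simp

theorem evenPart_cons_pair {w : Atom B} {i j : I} (hw : IsPair deg φ w i j) (x : FactMonoid B) :
    evenPart deg (w ::ₘ x) = evenPart deg x := by
  rw [evenPart_cons, h.deg_pair hw]
  simp

theorem ne_of_hasEven {w : Atom B} {i j : I} (hw : IsPair deg φ w i j) (hi : HasEven deg φ i) :
    i ≠ j :=
  (h.isPair_admissible hw).resolve_right (not_not_intro hi)

theorem exists_pairs {x : FactMonoid B} {i : I} (hE : HasEven deg φ i)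
    (hi : 2 ≤ (oddPart deg x).count i) :
    ∃ w w' R u v, x = w ::ₘ w' ::ₘ R ∧ IsPair deg φ w i u ∧ IsPair deg φ w' i v := by
  obtain ⟨w, hw, u, hp⟩ := h.exists_pair_of_mem_oddPart
    (Multiset.count_pos.1 (show 0 < (oddPart deg x).count i by omega))
  obtain ⟨x', rfl⟩ := Multiset.exists_cons_of_mem hw
  have hiu := h.ne_of_hasEven hp hE
  rw [h.oddPart_cons_pair hp] at hi
  simp only [Multiset.insert_eq_cons, Multiset.count_add, Multiset.count_cons_self,
    Multiset.count_singleton, hiu, ↓reduceIte] at hi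
  obtain ⟨w', hw', v, hp'⟩ := h.exists_pair_of_mem_oddPart
    (Multiset.count_pos.1 (show 0 < (oddPart deg x').count i by omega))
  obtain ⟨R, rfl⟩ := Multiset.exists_cons_of_mem hw'
  exact ⟨w, w', R, u, v, rfl, hp, hp'⟩

theorem hasEven_of_mem_evenPart {x : FactMonoid B} {i : I} (hi : i ∈ evenPart deg x) :
    HasEven deg φ i := by
  obtain ⟨w, -, hw⟩ := h.exists_single_of_mem_evenPart hi
  exact ⟨w.1, hw, (h.mem_iff _).1 w.1.2⟩

theorem exists_odd_of_mem_oddPart {x : FactMonoid B} {i : I} (hi : i ∈ oddPart deg x) :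
    ∃ e, deg e = {i} ∧ φ e ≠ 1 := by
  obtain ⟨w, -, u, a, b, -, ha, -, hφ, -⟩ := h.exists_pair_of_mem_oddPart hi
  exact ⟨a, ha, hφ⟩

theorem count_deg_le_one {w : Atom B} {i : I} (hE : HasEven deg φ i) :
    (deg (w.1 : M)).count i ≤ 1 := by
  rcases h.single_or_pair w with ⟨j, hj⟩ | ⟨j, k, hp⟩
  · rw [hj, Multiset.count_singleton]
    split_ifs <;> omega
  · have hadm := h.isPair_admissible hp
    rw [h.deg_pair hp]
    simp only [Multiset.insert_eq_cons, Multiset.count_cons, Multiset.count_singleton]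
    split_ifs with h1 h2
    · subst h1 h2
      rcases hadm with hne | hne
      · exact absurd rfl hne
      · exact absurd hE hne
    all_goals omega

/-- A color with an even element occurs at most once in each pair. -/
theorem count_oddPart_le {x : FactMonoid B} {i : I} (hE : HasEven deg φ i) :
    (oddPart deg x).count i ≤ numPairs deg x := by
  induction x using Multiset.induction with
  | empty => simp
  | cons w x ih =>
    rw [oddPart_cons, numPairs_cons, Multiset.count_add]
    have := h.count_deg_le_one (w := w) hE
    split_ifs
    · omega
    · simpa using ih

omit h in
theorem le_count_oddPart {x : FactMonoid B} {i : I}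
    (hx : ∀ w ∈ x, Multiset.card (deg (w.1 : M)) = 2 → i ∈ deg (w.1 : M)) :
    numPairs deg x ≤ (oddPart deg x).count i := by
  induction x using Multiset.induction with
  | empty => simp
  | cons w x ih =>
    have := ih fun v hv => hx v (Multiset.mem_cons_of_mem hv)
    rw [oddPart_cons, numPairs_cons, Multiset.count_add]
    split_ifs with h2
    · have := Multiset.count_pos.2 (hx w (by simp) h2)
      omega
    · simpa using this

/-- In the component of color `i`, each odd factor contributes the nontrivial class and each single
the trivial one. The parity is therefore an invariant of the product, so counts of odd factors that
differ do so by at least two. -/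
theorem pr_factProd_eq_one_iff (i : I) (x : FactMonoid B) :
    φ (pr i ((factProd x : B) : M)) = 1 ↔ Even ((oddPart deg x).count i) := by
  have hmul : ∀ g k : G, g * k = 1 ↔ (g = 1 ↔ k = 1) := by
    intro g k
    by_cases hg : g = 1
    · simp [hg]
    by_cases hk : k = 1
    · simp [hk]
    simp [hg, hk, h.mul_eq_one g k hg hk]
  have htok : ∀ a j, deg a = {j} → φ a ≠ 1 →
      (φ (pr i a) = 1 ↔ Even (Multiset.count i {j})) := by
    intro a j ha hφ
    rw [Multiset.count_singleton]
    split_ifs with hij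
    · subst hij
      rw [h.pr_self i a (by simp [ha])]
      simpa using hφ
    · rw [h.pr_eq_one i a (by simpa [ha] using hij)]
      simp
  induction x using Multiset.induction with
  | empty => simp
  | cons w x ih =>
    rw [factProd_cons, Submonoid.coe_mul, map_mul, map_mul, hmul, oddPart_cons,
      Multiset.count_add, Nat.even_add]
    have key : φ (pr i (w.1 : M)) = 1 ↔ Even (Multiset.count i
        (if Multiset.card (deg (w.1 : M)) = 2 then deg (w.1 : M) else 0)) := by
      rcases h.single_or_pair w with ⟨j, hj⟩ | ⟨j, k, hp⟩
      · simp only [hj, Multiset.card_singleton, OfNat.one_ne_ofNat, ↓reduceIte,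
          Multiset.count_zero, Even.zero, iff_true]
        by_cases hij : i = j
        · subst hij
          rw [h.pr_self i _ (by simp [hj])]
          exact (h.mem_iff _).1 w.1.2
        · rw [h.pr_eq_one i _ (by simpa [hj] using hij), map_one]
      · rw [if_pos (by simp [h.deg_pair hp]), h.deg_pair hp]
        obtain ⟨a, b, hab, ha, hb, hφa, hφb⟩ := hp
        rw [hab, map_mul, map_mul, hmul, htok a j ha hφa, htok b k hb hφb, ← Nat.even_add,
          ← Multiset.count_add]
        rfl
    exact iff_congr key ih

theorem add_two_le_count_oddPart {x y : FactMonoid B} (hxy : factProd x = factProd y) {i : I}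
    (hi : (oddPart deg y).count i < (oddPart deg x).count i) :
    (oddPart deg y).count i + 2 ≤ (oddPart deg x).count i := by
  have h1 := h.pr_factProd_eq_one_iff i x
  rw [hxy, h.pr_factProd_eq_one_iff i y, Nat.even_iff, Nat.even_iff] at h1
  omega

theorem count_evenPart_add {x y : FactMonoid B} (hxy : factProd x = factProd y) (i : I) :
    (evenPart deg x).count i + (oddPart deg x).count i =
      (evenPart deg y).count i + (oddPart deg y).count i := by
  rw [← Multiset.count_add, ← Multiset.count_add, h.evenPart_add_oddPart, h.evenPart_add_oddPart,
    hxy]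

theorem mem_evenPart_of_lt {x y : FactMonoid B} (hxy : factProd x = factProd y) {i : I}
    (hi : (oddPart deg y).count i < (oddPart deg x).count i) : i ∈ evenPart deg y := by
  have := h.count_evenPart_add hxy i
  exact Multiset.count_pos.1 (by omega)

theorem two_le_count_evenPart {x y : FactMonoid B} (hxy : factProd x = factProd y) {i : I}
    (hi : (oddPart deg y).count i < (oddPart deg x).count i) :
    2 ≤ (evenPart deg y).count i := by
  have := h.count_evenPart_add hxy i
  have := h.add_two_le_count_oddPart hxy hi
  omega

/-- The way every move is finished: once a single of a color that is also a single in `y` has been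
created, `chain_of_common_deg` leads on to `y`. -/
theorem chain_of_chain_single {x y z : FactMonoid B} (hxy : factProd x = factProd y)
    (hx3 : 3 ≤ Multiset.card x) (hz : MonotoneRChain x z)
    (hzy : Multiset.card z ≤ Multiset.card y) {i : I} {w : Atom B} (hw : w ∈ z)
    (hd : deg (w.1 : M) = {i}) (hi : i ∈ evenPart deg y) : MonotoneRChain x y := by
  obtain ⟨v, hv, hdv⟩ := h.exists_single_of_mem_evenPart hi
  exact hz.trans (h.chain_of_common_deg (hz.factProd_eq.symm.trans hxy)
    (hx3.trans hz.card_le) hzy hw hv (hd.trans hdv.symm))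

/-- By parity the surpluses are at least two, so `x` contains pairs `(i u)`, `(i v)` and singles
`(l)`, `(l)`. The move `(i u)(i v)(l)(l) = (i)(i)(l u)(l v)` preserves the length; it is available
because `u` and `v` differ from `l`. It touches four atoms, hence the bound five. -/
theorem chain_of_count_lt_of_count_lt {x y : FactMonoid B} (hxy : factProd x = factProd y)
    (hx5 : 5 ≤ Multiset.card x) (hc : Multiset.card x ≤ Multiset.card y) {i l : I}
    (hi : (oddPart deg y).count i < (oddPart deg x).count i)
    (hl : (oddPart deg x).count l < (oddPart deg y).count l)
    (hil : ∀ w ∈ x, ¬ IsPair deg φ w i l) : MonotoneRChain x y := by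
  have hiy := h.mem_evenPart_of_lt hxy hi
  have hE := h.hasEven_of_mem_evenPart hiy
  have hi2 := h.add_two_le_count_oddPart hxy hi
  have hl2 := h.two_le_count_evenPart hxy.symm hl
  obtain ⟨p, p', R, u, v, rfl, hp, hp'⟩ := h.exists_pairs (x := x) hE (by omega)
  rw [h.evenPart_cons_pair hp, h.evenPart_cons_pair hp'] at hl2
  obtain ⟨q, q', R, rfl, hq, hq'⟩ := h.exists_singles hl2
  have hlu : l ≠ u := by
    rintro rfl
    exact hil p (by simp) hp
  have hlv : l ≠ v := by
    rintro rfl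
    exact hil p' (by simp) hp'
  obtain ⟨z, hz, hzc, w, hw, hd⟩ := h.exchange_pairs rfl hx5 hp hp' hq hq' hE
    (h.exists_odd_of_mem_oddPart (x := y) (Multiset.count_pos.1 (by omega))) hlu hlv
  exact h.chain_of_chain_single hxy (by omega) hz (by omega) hw hd hiy

/-- Splitting two pairs `(i u)`, `(i v)` works unless `u = v` has an even element. So the
obstruction is that all pairs through `i` have one and the same partner `j`. In that case `(i j)(i
j) = (i)(i)(j)(j)` lengthens by two, which is too much only if `|y| = |x| + 1`. -/
theorem chain_or_forall_pair {x y : FactMonoid B} (hxy : factProd x = factProd y)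
    (hx3 : 3 ≤ Multiset.card x) (hc : Multiset.card x < Multiset.card y) {i : I}
    (hi : (oddPart deg y).count i < (oddPart deg x).count i) :
    MonotoneRChain x y ∨ ∃ j p p' R, x = p ::ₘ p' ::ₘ R ∧ IsPair deg φ p i j ∧
      IsPair deg φ p' i j ∧ HasEven deg φ i ∧ HasEven deg φ j ∧
      (∀ q ∈ x, ∀ u, IsPair deg φ q i u → u = j) ∧ Multiset.card y = Multiset.card x + 1 := by
  have hiy := h.mem_evenPart_of_lt hxy hi
  have hE := h.hasEven_of_mem_evenPart hiy
  have hi2 := h.add_two_le_count_oddPart hxy hi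
  have hsplit : ∀ p p' R u v, x = p ::ₘ p' ::ₘ R → IsPair deg φ p i u → IsPair deg φ p' i v →
      Admissible deg φ u v → MonotoneRChain x y := by
    intro p p' R u v hx hp hp' huv
    obtain ⟨z, hz, hzc, w, hw, hd⟩ := h.split_pairs hx hx3 hp hp' hE huv
    exact h.chain_of_chain_single hxy hx3 hz (by omega) hw hd hiy
  obtain ⟨p, p', R, j, v, hx, hp, hp'⟩ := h.exists_pairs (x := x) hE (by omega)
  by_cases hjv : Admissible deg φ j v
  · exact Or.inl (hsplit _ _ _ _ _ hx hp hp' hjv)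
  obtain ⟨rfl, hEj⟩ := not_admissible_iff.1 hjv
  by_cases hq : ∀ q ∈ x, ∀ u, IsPair deg φ q i u → u = j
  · by_cases hc1 : Multiset.card y = Multiset.card x + 1
    · exact Or.inr ⟨j, p, p', R, hx, hp, hp', hE, hEj, hq, hc1⟩
    · left
      obtain ⟨z, hz, hzc, w, hw, hd⟩ := h.split_pairs_two hx hx3 hp hp' hE hEj
      exact h.chain_of_chain_single hxy hx3 hz (by omega) hw hd hiy
  · left
    push Not at hq
    obtain ⟨q, hqx, u, hqu, huj⟩ := hq
    have hpq : p ≠ q := by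
      rintro rfl
      have := (h.deg_pair hp).symm.trans (h.deg_pair hqu)
      exact huj (by simpa using this.symm)
    obtain ⟨R', hR'⟩ := exists_eq_cons_cons (by simp [hx]) hqx hpq
    exact hsplit _ _ _ _ _ hR' hp hqu (Or.inl (Ne.symm huj))

/-- Only the obstruction of `chain_or_forall_pair` needs work. A pair avoiding `j` allows a
splitting with three atoms; if there is none, all pairs of `x` turn out to be `(i j)`, and a third
color `l` is exchanged instead. -/
theorem chain_of_card_lt {x y : FactMonoid B} (hxy : factProd x = factProd y)
    (hc : Multiset.card x < Multiset.card y) (hy5 : 5 ≤ Multiset.card y) :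
    MonotoneRChain x y := by
  have hx := h.card_add_numPairs x
  have hy := h.card_add_numPairs y
  rw [hxy] at hx
  have hnx := h.card_evenPart_add_numPairs x
  -- At most `|x|` atoms of `x` are pairs, so `2|x| ≥ |y| ≥ 5`.
  have hx3 : 3 ≤ Multiset.card x := by omega
  obtain ⟨i, hi⟩ : ∃ i, (oddPart deg y).count i < (oddPart deg x).count i := by
    by_contra hcon
    push Not at hcon
    have := Multiset.card_le_card (Multiset.le_iff_count.2 hcon)
    rw [card_oddPart, card_oddPart] at this
    omega
  rcases h.chain_or_forall_pair hxy hx3 hc hi with hch | ⟨j, p, p', R, hxR, hp, hp', hEi, hEj,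
    hij, hc1⟩
  · exact hch
  have hne := h.ne_of_hasEven hp hEi
  have hiy := h.mem_evenPart_of_lt hxy hi
  by_cases hall : ∀ w ∈ x, Multiset.card (deg (w.1 : M)) = 2 → j ∈ deg (w.1 : M)
  · have hj1 := le_count_oddPart hall
    have hj2 := h.count_oddPart_le (x := y) hEj
    -- Every pair of `x` contains `j`, and `y` has one pair fewer than `x`, so `j` has a surplus in
    -- `x` as well.
    have hj : (oddPart deg y).count j < (oddPart deg x).count j := by omega
    rcases h.chain_or_forall_pair hxy hx3 hc hj with hch | ⟨i', -, -, -, -, -, -, -, -, hji, -⟩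
    · exact hch
    obtain rfl : i = i' := hji p (by simp [hxR]) i hp.symm
    have hix := h.count_oddPart_le (x := x) hEi
    have hjx := h.count_oddPart_le (x := x) hEj
    have hi2 := h.add_two_le_count_oddPart hxy hi
    have hj2 := h.add_two_le_count_oddPart hxy hj
    -- With `n` pairs in `x`, the odd part of `y` has `2n - 2` entries, of which at most `n - 2` are
    -- `i` and at most `n - 2` are `j`.
    obtain ⟨l, hly, hli, hlj⟩ : ∃ l ∈ oddPart deg y, l ≠ i ∧ l ≠ j := by
      by_contra hcon
      push Not at hcon
      have := card_eq_count_add_count (s := oddPart deg y) hne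
        (fun c hc => or_iff_not_imp_left.2 (hcon c hc))
      rw [card_oddPart] at this
      omega
    have hlx : l ∉ oddPart deg x := by
      intro hmem
      obtain ⟨q, hq, u, hqu⟩ := h.exists_pair_of_mem_oddPart hmem
      have hjq := hall q hq (by simp [h.deg_pair hqu])
      obtain rfl : j = u := by
        simpa [h.deg_pair hqu, Ne.symm hlj] using hjq
      exact hli (hji q hq l hqu.symm)
    have hl : (oddPart deg x).count l < (oddPart deg y).count l := by
      rw [Multiset.count_eq_zero_of_notMem hlx]
      exact Multiset.count_pos.2 hly
    have hl2 := h.add_two_le_count_oddPart hxy.symm hl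
    have hle := h.two_le_count_evenPart hxy.symm hl
    have hEl := h.hasEven_of_mem_evenPart (Multiset.count_pos.1 (pos_of_gt hle))
    have hly2 := h.count_oddPart_le (x := y) hEl
    have hle' := Multiset.count_le_card l (evenPart deg x)
    -- Color `l` is odd at least twice in `y` and at most once per pair, so `y` has at least two
    -- pairs and `x` at least three. With the two singles `(l)` this gives `|x| ≥ 5`.
    refine h.chain_of_count_lt_of_count_lt hxy (by omega) hc.le hi hl ?_
    intro q hq hqp
    exact hlj (hij q hq l hqp)
  · push Not at hall
    obtain ⟨q, hqx, hq2, hjq⟩ := hall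
    have hiq : i ∉ deg (q.1 : M) := by
      intro hmem
      obtain ⟨u, hu⟩ := h.pair_of_mem hmem hq2
      obtain rfl := hij q hqx u hu
      exact hjq (by simp [h.deg_pair hu])
    have hqR : q ∈ R := by
      rw [hxR, Multiset.mem_cons, Multiset.mem_cons] at hqx
      rcases hqx with rfl | rfl | hqx
      · exact absurd (by simp [h.deg_pair hp]) hiq
      · exact absurd (by simp [h.deg_pair hp']) hiq
      · exact hqx
    obtain ⟨R', rfl⟩ := Multiset.exists_cons_of_mem hqR
    rcases h.single_or_pair q with ⟨k, hk⟩ | ⟨a, b, hab⟩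
    · simp [hk] at hq2
    rw [h.deg_pair hab] at hjq
    simp only [Multiset.insert_eq_cons, Multiset.mem_cons, Multiset.mem_singleton,
      not_or] at hjq
    -- Here `|y| = |x| + 1 ≥ 5` provides the four atoms needed by the move.
    obtain ⟨z, hz, hzc, w, hw, hd⟩ := h.split_pairs_of_pair hxR (by omega) hp hp' hab hEi
      (Or.inl hjq.1) (Or.inl hjq.2)
    exact h.chain_of_chain_single hxy hx3 hz (by omega) hw hd hiy

theorem count_deg_factProd_le {x : FactMonoid B} {a c d : I}
    (hx : ∀ w ∈ x, (deg (w.1 : M)).count c + (deg (w.1 : M)).count d ≤ (deg (w.1 : M)).count a) :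
    (deg ((factProd x : B) : M)).count c + (deg ((factProd x : B) : M)).count d ≤
      (deg ((factProd x : B) : M)).count a := by
  induction x using Multiset.induction with
  | empty => simp [h.deg_one]
  | cons w x ih =>
    have h1 := ih fun v hv => hx v (Multiset.mem_cons_of_mem hv)
    have h2 := hx w (by simp)
    simp only [factProd_cons, Submonoid.coe_mul, h.deg_mul, Multiset.count_add]
    omega

omit [DecidableEq I] h in
theorem exists_maximal_color [DecidableEq I] {s : Multiset I} (hs : s ≠ 0) (p : I → Prop) :
    ∃ c ∈ s, ∀ a ∈ s, p a → p c ∧ s.count a ≤ s.count c := by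
  classical
  by_cases hp : ∃ a ∈ s, p a
  · obtain ⟨c, hc, hmax⟩ := (s.toFinset.filter p).exists_max_image (fun a => s.count a) (by
      obtain ⟨a, ha, hpa⟩ := hp
      exact ⟨a, by simp [ha, hpa]⟩)
    rw [Finset.mem_filter, Multiset.mem_toFinset] at hc
    exact ⟨c, hc.1, fun a ha hpa => ⟨hc.2, hmax a (by simp [ha, hpa])⟩⟩
  · obtain ⟨c, hc⟩ := Multiset.exists_mem_of_ne_zero hs
    exact ⟨c, hc, fun a ha hpa => absurd ⟨a, ha, hpa⟩ hp⟩

/-- Both factorizations consist of pairs only. A pair `(c d)` of `y` is built in `x` by `(c a)(d b)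
= (c d)(a b)`, which fails only if `a = b` has an even element. To exclude this, `c` is chosen of
maximal multiplicity among the colors with an even element, if there are any. -/
theorem chain_of_evenPart_eq_zero {x y : FactMonoid B} (hxy : factProd x = factProd y)
    (hx3 : 3 ≤ Multiset.card x) (hc : Multiset.card x ≤ Multiset.card y)
    (hex : evenPart deg x = 0) (hey : evenPart deg y = 0)
    (hnc : ∀ w ∈ x, ∀ v ∈ y, deg (w.1 : M) ≠ deg (v.1 : M)) : MonotoneRChain x y := by
  have hpx : ∀ w ∈ x, ∀ i ∈ deg (w.1 : M), ∃ u, IsPair deg φ w i u := by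
    intro w hw i hi
    refine h.pair_of_mem hi ((h.card_deg w).resolve_left fun h1 => ?_)
    obtain ⟨j, hj⟩ := Multiset.card_eq_one.1 h1
    have := mem_evenPart_of_deg_eq hw hj
    simp [hex] at this
  have hpy : ∀ w ∈ y, ∀ i ∈ deg (w.1 : M), ∃ u, IsPair deg φ w i u := by
    intro w hw i hi
    refine h.pair_of_mem hi ((h.card_deg w).resolve_left fun h1 => ?_)
    obtain ⟨j, hj⟩ := Multiset.card_eq_one.1 h1
    have := mem_evenPart_of_deg_eq hw hj
    simp [hey] at this
  have hs0 : deg ((factProd x : B) : M) ≠ 0 := by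
    rw [Ne, ← Multiset.card_eq_zero, ← h.card_add_numPairs]
    omega
  obtain ⟨c, hcs, hmax⟩ := exists_maximal_color hs0 (HasEven deg φ)
  obtain ⟨v, hv, hcv⟩ := h.mem_deg_factProd.1 (hxy ▸ hcs)
  obtain ⟨d, hvp⟩ := hpy v hv c hcv
  obtain ⟨p, hp, hcp⟩ := h.mem_deg_factProd.1 hcs
  obtain ⟨a, hpp⟩ := hpx p hp c hcp
  have hcd := h.isPair_admissible hvp
  have had : d ≠ a := by
    rintro rfl
    exact hnc p hp v hv ((h.deg_pair hpp).trans (h.deg_pair hvp).symm)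
  have hswap : ∀ q q' R s t, x = q ::ₘ q' ::ₘ R → IsPair deg φ q c s → IsPair deg φ q' d t →
      Admissible deg φ s t → MonotoneRChain x y := by
    intro q q' R s t hx hq hq' hst
    obtain ⟨z, hz, hzc, w, hw, hd⟩ := h.swap_pairs hx hx3 hq hq' hcd hst
    exact hz.trans (h.chain_of_common_deg (hz.factProd_eq.symm.trans hxy)
      (by omega) (by omega) hw hv (hd.trans (h.deg_pair hvp).symm))
  obtain ⟨x', hx'⟩ := Multiset.exists_cons_of_mem hp
  obtain ⟨y', hy'⟩ := Multiset.exists_cons_of_mem hv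
  have hdx' : d ∈ deg ((factProd x' : B) : M) := by
    have hM := congrArg (fun t : B => deg (t : M)) hxy
    simp only [hx', hy', factProd_cons, Submonoid.coe_mul, h.deg_mul, h.deg_pair hpp,
      h.deg_pair hvp, Multiset.insert_eq_cons, Multiset.cons_add, Multiset.cons_inj_right] at hM
    have hmem : d ∈ {a} + deg ((factProd x' : B) : M) := by
      rw [hM]
      simp
    simpa [had] using hmem
  obtain ⟨p', hp', hdp'⟩ := h.mem_deg_factProd.1 hdx'
  have hp'x : p' ∈ x := by
    rw [hx']
    exact Multiset.mem_cons_of_mem hp'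
  obtain ⟨b, hpp'⟩ := hpx p' hp'x d hdp'
  obtain ⟨R, rfl⟩ := Multiset.exists_cons_of_mem hp'
  by_cases hab : Admissible deg φ a b
  · exact hswap _ _ _ _ _ hx' hpp hpp' hab
  obtain ⟨rfl, hEa⟩ := not_admissible_iff.1 hab
  have has : a ∈ deg ((factProd x : B) : M) :=
    h.mem_deg_factProd.2 ⟨p, hp, by simp [h.deg_pair hpp]⟩
  have hds : d ∈ deg ((factProd x : B) : M) := h.mem_deg_factProd.2 ⟨p', hp'x, hdp'⟩
  obtain ⟨hEc, hle⟩ := hmax a has hEa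
  have hca := h.ne_of_hasEven hpp hEc
  have hcd' := h.ne_of_hasEven hvp hEc
  -- If `c` and `d` occurred in `x` only together with partner `a`, then `a` would be more frequent
  -- than `c`, against maximality. Otherwise some pair `(c s)` with `s ≠ a`, or `(d t)` with `t ≠
  -- a`, makes the swap admissible.
  by_cases hall : ∀ w ∈ x, (deg (w.1 : M)).count c + (deg (w.1 : M)).count d ≤
      (deg (w.1 : M)).count a
  · have h1 := h.count_deg_factProd_le hall
    have h2 := Multiset.count_pos.2 hds
    omega
  push Not at hall
  obtain ⟨w, hw, hlt⟩ := hall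
  by_cases hcw : c ∈ deg (w.1 : M)
  · obtain ⟨s, hws⟩ := hpx w hw c hcw
    have hsa : s ≠ a := by
      rintro rfl
      rw [h.deg_pair hws] at hlt
      simp [hca, Ne.symm hca, had,
        Ne.symm hcd'] at hlt
    have hwp' : w ≠ p' := by
      rintro rfl
      rw [h.deg_pair hpp'] at hcw
      simp [hca, hcd'] at hcw
    obtain ⟨R', hR'⟩ := exists_eq_cons_cons hw hp'x hwp'
    exact hswap _ _ _ _ _ hR' hws hpp' (Or.inl hsa)
  · have hdw : d ∈ deg (w.1 : M) := by
      by_contra hdw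
      rw [Multiset.count_eq_zero_of_notMem hcw, Multiset.count_eq_zero_of_notMem hdw] at hlt
      omega
    obtain ⟨t, hwt⟩ := hpx w hw d hdw
    have hta : a ≠ t := by
      rintro rfl
      rw [h.deg_pair hwt] at hlt
      simp [hca, had, Ne.symm had,
        hcd'] at hlt
    have hpw : p ≠ w := by
      rintro rfl
      exact hcw hcp
    obtain ⟨R', hR'⟩ := exists_eq_cons_cons hp hw hpw
    exact hswap _ _ _ _ _ hR' hpp hwt (Or.inl hta)

/-- One may assume that no atom of `x` has the colors of an atom of `y`. If the odd parts agree, so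
do the even parts, which must then be empty. If not, each side has a surplus color, and these are
exchanged. -/
theorem chain_of_card_eq {x y : FactMonoid B} (hxy : factProd x = factProd y)
    (hc : Multiset.card x = Multiset.card y) (hy5 : 5 ≤ Multiset.card y) :
    MonotoneRChain x y := by
  by_cases hnc : ∀ w ∈ x, ∀ v ∈ y, deg (w.1 : M) ≠ deg (v.1 : M)
  swap
  · push Not at hnc
    obtain ⟨w, hw, v, hv, hd⟩ := hnc
    exact h.chain_of_common_deg hxy (by omega) hc.le hw hv hd
  have hx := h.card_add_numPairs x
  have hy := h.card_add_numPairs y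
  rw [hxy] at hx
  have hcard : Multiset.card (oddPart deg x) = Multiset.card (oddPart deg y) := by
    rw [card_oddPart, card_oddPart]
    omega
  by_cases hodd : oddPart deg x = oddPart deg y
  · have heven : evenPart deg x = evenPart deg y := by
      have := (h.evenPart_add_oddPart x).trans ((hxy ▸ h.evenPart_add_oddPart y).symm)
      rw [hodd] at this
      exact add_right_cancel this
    have hex : evenPart deg x = 0 := by
      rw [Multiset.eq_zero_iff_forall_notMem]
      intro i hi
      obtain ⟨w, hw, hd⟩ := h.exists_single_of_mem_evenPart hi
      obtain ⟨v, hv, hd'⟩ := h.exists_single_of_mem_evenPart (heven ▸ hi)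
      exact hnc w hw v hv (hd.trans hd'.symm)
    exact h.chain_of_evenPart_eq_zero hxy (by omega) hc.le hex (heven ▸ hex) hnc
  · have hex : ∀ s t : Multiset I, Multiset.card s = Multiset.card t → s ≠ t →
        ∃ i, t.count i < s.count i := by
      intro s t hst hne
      by_contra hcon
      push Not at hcon
      exact hne (Multiset.eq_of_le_of_card_le (Multiset.le_iff_count.2 hcon) hst.ge)
    obtain ⟨i, hi⟩ := hex _ _ hcard hodd
    obtain ⟨l, hl⟩ := hex _ _ hcard.symm (Ne.symm hodd)
    by_cases hil : ∀ w ∈ x, ¬ IsPair deg φ w i l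
    · exact h.chain_of_count_lt_of_count_lt hxy (by omega) hc.le hi hl hil
    · push Not at hil
      obtain ⟨w, hw, hwp⟩ := hil
      -- A pair `(i l)` in `x` blocks the exchange there, but then `y` has no such pair. So the
      -- exchange is made in `y`, and the chain is reversed, its length being constant.
      refine (h.chain_of_count_lt_of_count_lt hxy.symm hy5 hc.ge hl hi ?_).symm hc.symm
      intro v hv hvp
      exact hnc w hw v hv ((h.deg_pair hwp).trans (h.deg_pair hvp.symm).symm)

theorem monotoneRChain {x y : FactMonoid B} (hxy : factProd x = factProd y)
    (hc : Multiset.card x ≤ Multiset.card y) (hy5 : 5 ≤ Multiset.card y) :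
    MonotoneRChain x y := by
  rcases hc.lt_or_eq with hc | hc
  · exact h.chain_of_card_lt hxy hc hy5
  · exact h.chain_of_card_eq hxy hc hy5

end IsColoredKernel

end OddPart

/-! ### Degree functions on reduced monoids of type `(1, 1)`. -/

/-- A degree function on a monoid, such that elements of degree at least two are divisible by
all elements of degree one. -/
structure IsDegreeFunction {S : Type*} [CommMonoid S] (d : S → ℕ) : Prop where
  map_mul : ∀ a b, d (a * b) = d a + d b
  eq_one : ∀ a, d a = 0 → a = 1
  exists_eq_one : ∃ u, d u = 1
  dvd : ∀ a u, 2 ≤ d a → d u = 1 → u ∣ a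

namespace IsDegreeFunction

variable {S : Type*} [CommMonoid S] {d : S → ℕ} (hd : IsDegreeFunction d)
include hd

theorem map_one : d 1 = 0 := by
  have := hd.map_mul 1 1
  rw [mul_one] at this
  omega

theorem exists_dvd {a : S} (ha : d a ≠ 0) : ∃ u, d u = 1 ∧ u ∣ a := by
  by_cases h1 : d a = 1
  · exact ⟨a, h1, dvd_rfl⟩
  · obtain ⟨u, hu⟩ := hd.exists_eq_one
    exact ⟨u, hu, hd.dvd a u (by omega) hu⟩

end IsDegreeFunction

/-- The degree is the `p`-adic valuation in `F`. Nonunits lie in `pF`, so valuation zero means unit,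
hence `1`. -/
theorem exists_isDegreeFunction {S : Type*} [CommMonoid S] (hred : IsReducedMonoid S)
    (htype : IsOfType S 1 1) : ∃ d : S → ℕ, IsDegreeFunction d := by
  obtain ⟨F, _, j, p, hj, -⟩ := htype
  have hsurj : ∀ f : F, ∃ (n : ℕ) (w : Fˣ), p ^ n * (w : F) = f := fun f => by
    obtain ⟨q, hq⟩ := hj.factorial.2 f
    exact ⟨q.1, q.2, hq⟩
  have huniq : ∀ (n m : ℕ) (w v : Fˣ), p ^ n * (w : F) = p ^ m * (v : F) → n = m := by
    intro n m w v h
    exact congrArg Prod.fst (@hj.factorial.1 (n, w) (m, v) h)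
  choose n w hnw using hsurj
  have hn : ∀ (k : ℕ) (v : Fˣ), n (p ^ k * (v : F)) = k := fun k v =>
    huniq _ _ _ _ (hnw (p ^ k * (v : F)))
  have hnmul : ∀ f g, n (f * g) = n f + n g := by
    intro f g
    conv_lhs => rw [← hnw f, ← hnw g]
    rw [mul_mul_mul_comm, ← pow_add, ← Units.val_mul, hn]
  refine ⟨fun a => n (j a), ⟨?_, ?_, ?_, ?_⟩⟩
  · intro a b
    rw [map_mul, hnmul]
  · intro a ha
    by_contra hne
    obtain ⟨f, hf⟩ := hj.nonunits a (fun hu => hne (hred a hu))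
    have hp : n p = 1 := by simpa using hn 1 1
    rw [hf, hnmul, hp] at ha
    omega
  · obtain ⟨a, ha⟩ := hj.exponent 1
    refine ⟨a, ?_⟩
    rw [ha]
    simpa using hn 1 1
  · intro a u ha hu
    have ea := hnw (j a)
    have eu := hnw (j u)
    rw [hu] at eu
    obtain ⟨k, hk⟩ := Nat.exists_eq_add_of_le ha
    rw [hk] at ea
    generalize w (j a) = v at ea
    generalize w (j u) = v' at eu
    -- The quotient of valuation `2 + k` by valuation `1` is `p` times this element; it has positive
    -- valuation and so lies in the monoid, by `pF ⊆ H`.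
    obtain ⟨b, hb⟩ := hj.exponent (p ^ k * ((v * v'⁻¹ : Fˣ) : F))
    refine ⟨b, hj.injective ?_⟩
    rw [map_mul, hb, ← ea, ← eu]
    calc p ^ (2 + k) * (v : F) = p ^ (2 + k) * ((v' * (v * v'⁻¹) : Fˣ) : F) := by
          rw [mul_inv_cancel_comm_assoc]
      _ = _ := by
          rw [pow_add, sq, pow_one, Units.val_mul]
          ac_rfl

/-! ### The block monoid as a colored kernel. -/

section BlockMonoid

universe v

theorem mulSingle_dvd {κ : Type*} {T : κ → Type*} [∀ i, CommMonoid (T i)] [DecidableEq κ]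
    {t : ∀ i, T i} {i : κ} {v : T i} (hv : v ∣ t i) : Pi.mulSingle i v ∣ t := by
  obtain ⟨w, hw⟩ := hv
  refine ⟨Function.update t i w, ?_⟩
  ext j
  by_cases hj : j = i
  · subst hj
    simp [hw]
  · simp [hj]

variable {κ : Type} {G : Type v} {T : κ → Type v} [Fintype κ]

/-- The multiset of colors of an element of `F(G) × ∏ Tᵢ`. -/
def blockDeg (d : ∀ i, T i → ℕ) (s : Multiplicative (Multiset G) × (∀ i, T i)) :
    Multiset (G ⊕ κ) :=
  s.1.toAdd.map Sum.inl + ∑ i, Multiset.replicate (d i (s.2 i)) (Sum.inr i)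

variable [DecidableEq G] [DecidableEq κ] {d : ∀ i, T i → ℕ}

theorem count_inl_blockDeg (s : Multiplicative (Multiset G) × (∀ i, T i)) (g : G) :
    (blockDeg d s).count (Sum.inl g) = s.1.toAdd.count g := by
  rw [blockDeg, Multiset.count_add, Multiset.count_map_eq_count' _ _ Sum.inl_injective,
    Multiset.count_sum', Finset.sum_eq_zero, add_zero]
  intro i _
  simp [Multiset.count_replicate]

theorem count_inr_blockDeg (s : Multiplicative (Multiset G) × (∀ i, T i)) (i : κ) :
    (blockDeg d s).count (Sum.inr i) = d i (s.2 i) := by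
  rw [blockDeg, Multiset.count_add, Multiset.count_sum', Multiset.count_eq_zero_of_notMem,
    zero_add, Finset.sum_eq_single i]
  · simp
  · intro j _ hj
    simp [Multiset.count_replicate, hj]
  · simp
  · simp

theorem blockDeg_ext {s : Multiplicative (Multiset G) × (∀ i, T i)} {m : Multiset (G ⊕ κ)}
    (h1 : ∀ g, s.1.toAdd.count g = m.count (Sum.inl g))
    (h2 : ∀ i, d i (s.2 i) = m.count (Sum.inr i)) : blockDeg d s = m := by
  ext (g | i)
  · rw [count_inl_blockDeg, h1]
  · rw [count_inr_blockDeg, h2]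

variable [∀ i, CommMonoid (T i)]

/-- The projection of `F(G) × ∏ Tᵢ` to a component. -/
def blockProj : G ⊕ κ → Multiplicative (Multiset G) × (∀ i, T i) →*
    Multiplicative (Multiset G) × (∀ i, T i)
  | Sum.inl g =>
    { toFun := fun s => (Multiplicative.ofAdd (Multiset.replicate (s.1.toAdd.count g) g), 1)
      map_one' := by simp
      map_mul' := fun s t => by
        simp [Multiset.replicate_add] }
  | Sum.inr i =>
    { toFun := fun s => (1, Pi.mulSingle i (s.2 i))
      map_one' := by simp
      map_mul' := fun s t => by simp [Pi.mulSingle_mul] }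

/-- The components of `M` do not interact, so each axiom is checked color by color. A color `g : G`
carries a single element of degree one, for which exchange is trivial; a color from `κ` inherits
exchange from `IsDegreeFunction.dvd`. -/
theorem isColoredKernel_blockMonoid [CommGroup G]
    (hG : Nat.card G = 2) (hd : ∀ i, IsDegreeFunction (d i)) (ι : (∀ i, T i) →* G) :
    IsColoredKernel (blockDeg d) blockProj
      ({ toFun := fun s => s.1.toAdd.prod * ι s.2
         map_one' := by simp
         map_mul' := fun s t => by
          simp [mul_mul_mul_comm] } : Multiplicative (Multiset G) × (∀ i, T i) →* G)
      (TBlockMonoid ι) where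
  deg_mul a b := blockDeg_ext
    (fun g => by rw [Multiset.count_add, count_inl_blockDeg, count_inl_blockDeg]; simp)
    (fun i => by
      rw [Multiset.count_add, count_inr_blockDeg, count_inr_blockDeg, ← (hd i).map_mul]; rfl)
  eq_one a ha := by
    refine Prod.ext ?_ (funext fun i => (hd i).eq_one _ ?_)
    · apply Multiplicative.toAdd.injective
      ext g
      rw [← count_inl_blockDeg (d := d), ha]
      simp
    · rw [← count_inr_blockDeg (d := d), ha]
      simp
  exists_dvd a i hi := by
    rw [← Multiset.count_pos] at hi
    rcases i with g | i
    · rw [count_inl_blockDeg, Multiset.count_pos] at hi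
      refine ⟨(Multiplicative.ofAdd {g}, 1), blockDeg_ext ?_ ?_, ?_⟩
      · intro k
        simp [Multiset.count_singleton]
      · intro i
        simp [(hd i).map_one]
      · obtain ⟨S, hS⟩ := Multiset.exists_cons_of_mem hi
        exact ⟨(Multiplicative.ofAdd S, a.2), Prod.ext hS (one_mul _).symm⟩
    · rw [count_inr_blockDeg] at hi
      obtain ⟨u, hu, hdvd⟩ := (hd i).exists_dvd hi.ne'
      refine ⟨(1, Pi.mulSingle i u), blockDeg_ext ?_ ?_, ?_⟩
      · intro k
        simp
      · intro j
        by_cases hj : j = i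
        · subst hj
          simp [hu]
        · simp [hj, (hd j).map_one]
      · obtain ⟨t, ht⟩ := mulSingle_dvd hdvd
        exact ⟨(a.1, t), Prod.ext (one_mul _).symm ht⟩
  dvd a i u ha hu := by
    rcases i with g | i
    · have h1 : u.1.toAdd = {g} := by
        ext k
        rw [← count_inl_blockDeg (d := d), hu]
        simp [Multiset.count_singleton]
      have h2 : u.2 = 1 := funext fun i => (hd i).eq_one _ (by
        rw [← count_inr_blockDeg (d := d), hu]
        simp)
      rw [count_inl_blockDeg] at ha
      obtain ⟨S, hS⟩ := Multiset.exists_cons_of_mem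
        (Multiset.count_pos.1 (show 0 < a.1.toAdd.count g by omega))
      refine ⟨(Multiplicative.ofAdd S, a.2), Prod.ext ?_ ?_⟩
      · apply Multiplicative.toAdd.injective
        simp [h1, hS]
      · simp [h2]
    · have h1 : u.1 = 1 := by
        apply Multiplicative.toAdd.injective
        ext k
        rw [← count_inl_blockDeg (d := d), hu]
        simp
      have h2 : u.2 = Pi.mulSingle i (u.2 i) := by
        ext j
        by_cases hj : j = i
        · subst hj
          simp
        · rw [Pi.mulSingle_eq_of_ne hj]
          apply (hd j).eq_one
          rw [← count_inr_blockDeg (d := d), hu]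
          simp [hj]
      have h3 : d i (u.2 i) = 1 := by
        rw [← count_inr_blockDeg (d := d), hu]
        simp
      rw [count_inr_blockDeg] at ha
      obtain ⟨t, ht⟩ := mulSingle_dvd ((hd i).dvd _ _ ha h3)
      rw [← h2] at ht
      exact ⟨(a.1, t), Prod.ext (by simp [h1]) ht⟩
  pr_self i a ha := by
    have hz : ∀ j, j ≠ i → (blockDeg d a).count j = 0 := fun j hj =>
      Multiset.count_eq_zero_of_notMem fun hm => hj (ha j hm)
    rcases i with g | i
    · refine Prod.ext ?_ (funext fun i => ((hd i).eq_one _ ?_).symm)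
      · apply Multiplicative.toAdd.injective
        ext k
        by_cases hk : k = g
        · subst hk
          simp [blockProj]
        · rw [← count_inl_blockDeg (d := d) a k, hz _ (by simpa using hk)]
          simp [blockProj, Multiset.count_replicate, Ne.symm hk]
      · rw [← count_inr_blockDeg (d := d)]
        exact hz _ (by simp)
    · refine Prod.ext ?_ (funext fun j => ?_)
      · apply Multiplicative.toAdd.injective
        ext k
        rw [← count_inl_blockDeg (d := d) a k, hz _ (by simp)]
        simp [blockProj]
      · by_cases hj : j = i
        · subst hj
          simp [blockProj]
        · have : a.2 j = 1 := by
            apply (hd j).eq_one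
            rw [← count_inr_blockDeg (d := d)]
            exact hz _ (by simpa using hj)
          simp [blockProj, hj, this]
  pr_eq_one i a ha := by
    rw [← Multiset.count_eq_zero] at ha
    rcases i with g | i
    · rw [count_inl_blockDeg] at ha
      simp [blockProj, ha]
    · rw [count_inr_blockDeg] at ha
      simp [blockProj, (hd i).eq_one _ ha]
  mul_eq_one g k hg hk := by
    obtain ⟨y, -, hy⟩ := (Nat.card_eq_two_iff' (1 : G)).1 hG
    rw [hy k hk, ← hy g⁻¹ (inv_ne_one.2 hg), mul_inv_cancel]
  mem_iff a := Iff.rfl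

end BlockMonoid

end NonUniqueFactorization

theorem lemma3p17 {D : Type*} [CancelCommMonoid D]
    (P : Set D) (hP : ∀ p ∈ P, NonUniqueFactorization.IsPrimeElement p)
    (r : ℕ) (hr : 1 ≤ r) (Di : Fin r → Submonoid D)
    (hD : NonUniqueFactorization.IsDirectProduct P Di)
    (hred : ∀ i, NonUniqueFactorization.IsReducedMonoid (Di i))
    (hhf : ∀ i, NonUniqueFactorization.IsHalfFactorial (Di i))
    (hnf : ∀ i, ¬ NonUniqueFactorization.IsFactorial (Di i))
    (htype : ∀ i, NonUniqueFactorization.IsOfType (Di i) 1 1)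
    (H : Submonoid D) (hsat : NonUniqueFactorization.IsSaturated H)
    (hcard : Nat.card (NonUniqueFactorization.ClassGrp H) = 2)
    (hclass : ∀ c : NonUniqueFactorization.ClassGrp H,
      ∃ p ∈ P, NonUniqueFactorization.classOf H p = c) :
    (∀ x y : NonUniqueFactorization.FactMonoid
          (NonUniqueFactorization.TBlockMonoid (NonUniqueFactorization.iotaHom H Di)),
        (x, y) ∈ NonUniqueFactorization.relationMonoid
          (NonUniqueFactorization.TBlockMonoid (NonUniqueFactorization.iotaHom H Di)) →
        Multiset.card x ≤ Multiset.card y → 5 ≤ Multiset.card y →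
          NonUniqueFactorization.MonotoneRChain x y ∧
          NonUniqueFactorization.RRelated x y ∧
          (Multiset.card x = Multiset.card y → NonUniqueFactorization.EqRRelated x y)) ∧
    NonUniqueFactorization.monCatenaryDegree
        (NonUniqueFactorization.TBlockMonoid (NonUniqueFactorization.iotaHom H Di)) ≤
      sSup {n : ℕ∞ | ∃ x y : NonUniqueFactorization.FactMonoid
          (NonUniqueFactorization.TBlockMonoid (NonUniqueFactorization.iotaHom H Di)),
        NonUniqueFactorization.IsRelationAtom x y ∧
        Multiset.card x ≤ Multiset.card y ∧ Multiset.card y ≤ 4 ∧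
        n = (Multiset.card y : ℕ∞)} := by
  classical
  choose d hd using fun i => NonUniqueFactorization.exists_isDegreeFunction (hred i) (htype i)
  have h := NonUniqueFactorization.isColoredKernel_blockMonoid hcard hd
    (NonUniqueFactorization.iotaHom H Di)
  have hcancel : ∀ a b c : NonUniqueFactorization.TBlockMonoid
      (NonUniqueFactorization.iotaHom H Di), a * b = a * c → b = c := by
    intro a b c habc
    have hM := congrArg Subtype.val habc
    refine Subtype.ext (Prod.ext ?_ (funext fun i => Subtype.ext ?_))
    · exact mul_left_cancel (congrArg Prod.fst hM)
    · exact mul_left_cancel (congrArg (fun s => ((s.2 i : Di i) : D)) hM)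
  refine ⟨fun x y hxy hc h5 => ?_, NonUniqueFactorization.monCatenaryDegree_le_sSup hcancel
    fun x y hxy hc h5 => h.monotoneRChain hxy hc h5⟩
  have hch := h.monotoneRChain hxy hc h5
  exact ⟨hch, hch.rRelated, hch.eqRRelated⟩
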